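/- Let $M$ be an $m$-dimensional (smooth) Riemannian manifold with inner products $\langle\cdot,\cdot\rangle_x$ and norms $\|\cdot\|_x$ on $T_xM$, and let $R:TM\to M$ be a $C^2$ retraction, i.e. a $C^2$ map whose restrictions $R_x=R|_{T_xM}$ satisfy $R_x(\mathbf 0_x)=x$ and $dR_x(\mathbf 0_x)=\mathrm{id}_{T_xM}$ for all $x\in M$. Let $(\Omega,\mu)$ be a probability space and let $f:M\times\Omega\to\mathbb R$ be a function, measurable in $\omega$ for each $x\in M$ and differentiable in $x$ for each $\omega\in\Omega$; write $\nabla_M f(x,\omega)$ for the Riemannian gradient of $f(\cdot,\omega)$ at $x$. Assume that: - $f$ and $\|\nabla_M f\|$ are locally bounded: for every compact $K\subset M$ each of them is bounded on $K\times\Omega$; - $f$ has locally $R$-Lipschitz gradient: for every compact $K\subset M$ and every $r>0$ there is $C_{K,r}>0$ such that the functions $f_{x,\omega}:=f(R_x(\cdot),\omega)$ on $T_xM$ satisfy $\|\nabla f_{x,\omega}(\mathbf v)-\nabla f_{x,\omega}(\mathbf 0_x)\|_x\le C_{K,r}\|\mathbf v\|_x$ for all $x\in K$, all $\mathbf v\in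 T_xM$ with $\|\mathbf v\|_x\le r$, and all $\omega\in\Omega$. Let $F(x)=\int_\Omega f(x,\omega)\,d\mu(\omega)$. Let $\rho:M\to\mathbb R$ be a $C^2$ function all of whose sublevel sets $\{x\in M\mid\rho(x)\le\delta\}$, $\delta\in\mathbb R$, are compact, and let $\rho_0\in\mathbb R$ be such that $\langle\nabla\rho(x),\nabla_M f(x,\omega)\rangle_x\ge 0$ for every $\omega\in\Omega$ and every $x\in M$ with $\rho(x)\ge\rho_0$. Let $\{\omega_t\}_{t\ge 0}$ be independent random variables with values in $\Omega$ and common distribution $\mu$. Fix constants $a,b,\Theta>0$ and positive numbers $\{c_t\}_{t\ge 0}$ with $\sum_{t}c_t=\infty$ and $\sum_{t}c_t^2<\infty$, and put $$c=\max_{t\ge 0} c_t,\qquad \sigma=\sum_{t=0}^\infty c_t^2,\qquad \rho_1=\rho_0+ca+\frac{b^2\sigma}{2}.$$ Fix $x_0\in M$ with $\rho(x_0)\le\rho_0$, and fix a constant $\varphi>0$ with $\varphi\ge\max\{A,B,\frac{c}{\Theta}\}$, where $$A=\frac1a\sup\left\{\max\{0,-\langle\nabla\rho(x),\nabla_M f(x,\omega)\rangle_x\}\;\middle|\;\rho(x)\le\rho_0,\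 \omega\in\Omega\right\},$$ $$B=\frac1b\sup\left\{\sqrt{\max\left\{0,\mathrm{Hess}(\rho\circ R_x)|_{\theta\nabla_M f(x,\omega)}\big(\nabla_M f(x,\omega),\nabla_M f(x,\omega)\big)\right\}}\;\middle|\;|\theta|\le\Theta,\ \rho(x)\le\rho_1,\ \omega\in\Omega\right\},$$ and $\mathrm{Hess}(\rho\circ R_x)$ is the Hessian of $\rho\circ R_x$ on the inner product space $T_xM$. Define random elements $x_t$ of $M$ by $$x_{t+1}=R_{x_t}\left(-\frac{c_t}{\varphi}\nabla_M f(x_t,\omega_t)\right),\qquad t\ge 0.$$ Then: 1. $\{x_t\}_{t\ge 0}$ is contained in the compact set $\{x\in M\mid\rho(x)\le\rho_1\}$; in particular it has convergent subsequences. 2. $F$ is differentiable on $M$, and $\{F(x_t)\}_{t\ge 0}$ converges almost surely to a finite number. 3. $\{\|\nabla F(x_t)\|_{x_t}\}_{t\ge 0}$ converges almost surely to $0$. 4. Almost surely, every limit point of $\{x_t\}_{t\ge 0}$ is a stationary point of $F$. -/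

import Mathlib

open scoped Manifold ContDiff Bundle Topology

noncomputable section RiemannianSGD

variable {m : ℕ} {M : Type*} [TopologicalSpace M]
  [ChartedSpace (EuclideanSpace ℝ (Fin m)) M] [IsManifold (𝓡 m) ∞ M]
  [Bundle.RiemannianBundle (fun x : M => TangentSpace (𝓡 m) x)]

instance tangentFiniteDimensional (x : M) : FiniteDimensional ℝ (TangentSpace (𝓡 m) x) :=
  inferInstanceAs (FiniteDimensional ℝ (EuclideanSpace ℝ (Fin m)))

/-- The tangent spaces, normed by the Riemannian metric, are complete, being finite-dimensional;
this is what makes Riesz duality (hence gradients) available on them. -/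
instance tangentCompleteSpace (x : M) : CompleteSpace (TangentSpace (𝓡 m) x) :=
  FiniteDimensional.complete ℝ (TangentSpace (𝓡 m) x)

/-- The Riemannian gradient of `g : M → ℝ` at `x`: the vector of `T_x M` dual to the differential
of `g` at `x` through the Riemannian inner product of `T_x M`. -/
def riemGrad (g : M → ℝ) (x : M) : TangentSpace (𝓡 m) x :=
  (InnerProductSpace.toDual ℝ (TangentSpace (𝓡 m) x)).symm (mfderiv (𝓡 m) 𝓘(ℝ, ℝ) g x)

/-- The restriction `R_x : T_x M → M` of a map `R : TM → M`. -/
def restrictFiber (R : TangentBundle (𝓡 m) M → M) (x : M) : TangentSpace (𝓡 m) x → M :=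
  fun v => R ⟨x, v⟩

/-- A retraction on `M`: a `C^1` map `R : TM → M` with `R_x(0) = x` and `dR_x(0) = id`. The
differential of `R_x` at `0` takes values in the tangent space at `R_x(0)`, which is the tangent
space at `x` because `R_x(0) = x`; the cast expresses this. -/
structure IsRetraction (R : TangentBundle (𝓡 m) M → M) : Prop where
  contMDiff : ContMDiff (𝓡 m).tangent (𝓡 m) 1 R
  map_zero : ∀ x : M, restrictFiber R x 0 = x
  mfderiv_zero : ∀ (x : M) (v : TangentSpace (𝓡 m) x),
    cast (congrArg (fun y : M => TangentSpace (𝓡 m) y) (map_zero x))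
      (mfderiv 𝓘(ℝ, TangentSpace (𝓡 m) x) (𝓡 m) (restrictFiber R x) 0 v) = v

/-- The Hessian at `v` of a real function `h` on an inner product space, as a bilinear form
evaluated at `(u, w)`. -/
def hessian {V : Type*} [NormedAddCommGroup V] [InnerProductSpace ℝ V] (h : V → ℝ) (v u w : V) :
    ℝ :=
  fderiv ℝ (fderiv ℝ h) v u w

variable {Ω : Type*}

/-- The gradient `∇_M f(x, ω)` in the `M`-direction of a random function `f`. -/
def gradM (f : M → Ω → ℝ) (x : M) (w : Ω) : TangentSpace (𝓡 m) x :=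
  riemGrad (fun y => f y w) x

variable (m) in
/-- `f` is first-order differentiable in the `M`-direction. -/
def DifferentiableInM (f : M → Ω → ℝ) : Prop :=
  ∀ w : Ω, MDifferentiable (𝓡 m) 𝓘(ℝ, ℝ) (fun x => f x w)

/-- A random function is locally bounded if it is bounded on `K × Ω` for every compact `K`. -/
def LocallyBoundedInM {X Ω : Type*} [TopologicalSpace X] (g : X → Ω → ℝ) : Prop :=
  ∀ K : Set X, IsCompact K → ∃ C : ℝ, 0 < C ∧ ∀ x ∈ K, ∀ w : Ω, |g x w| ≤ C

/-- `f` has locally `R`-Lipschitz gradient in the `M`-direction; here `f_{x,ω} = f(R_x(·), ω)` is a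
function on the inner product space `T_x M`, and `gradient` is its gradient there. -/
def HasLocallyRLipschitzGradient (R : TangentBundle (𝓡 m) M → M) (f : M → Ω → ℝ) : Prop :=
  ∀ K : Set M, IsCompact K → ∀ r : ℝ, 0 < r → ∃ C : ℝ, 0 < C ∧
    ∀ x ∈ K, ∀ v : TangentSpace (𝓡 m) x, ‖v‖ ≤ r → ∀ w : Ω,
      ‖gradient (fun u : TangentSpace (𝓡 m) x => f (restrictFiber R x u) w) v
        - gradient (fun u : TangentSpace (𝓡 m) x => f (restrictFiber R x u) w) 0‖ ≤ C * ‖v‖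

variable (m) in
/-- `⟨∇ρ(x), ∇_M f(x, ω)⟩_x ≥ 0` for every `ω` and every `x` with `ρ(x) ≥ ρ₀`. -/
def ConfinesAbove (f : M → Ω → ℝ) (ρ : M → ℝ) (ρ₀ : ℝ) : Prop :=
  ∀ (w : Ω) (x : M), ρ₀ ≤ ρ x →
    0 ≤ inner ℝ (riemGrad ρ x : TangentSpace (𝓡 m) x) (gradM f x w)

variable (m) in
/-- `ρ` is a confinement of the random function `f` on `M`. -/
structure IsConfinement (f : M → Ω → ℝ) (ρ : M → ℝ) : Prop where
  mdifferentiable : MDifferentiable (𝓡 m) 𝓘(ℝ, ℝ) ρ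
  isCompact_sublevel : ∀ δ : ℝ, IsCompact {x : M | ρ x ≤ δ}
  exists_confinesAbove : ∃ ρ₀ : ℝ, ConfinesAbove m f ρ ρ₀

variable (m) in
/-- `A = (1/a) sup { max{0, -⟨∇ρ(x), ∇_M f(x, ω)⟩_x} | ρ(x) ≤ ρ₀, ω ∈ Ω }`, the supremum being taken
in `[0, ∞]`, so that no convention on unbounded sets of reals enters. -/
def constA (f : M → Ω → ℝ) (ρ : M → ℝ) (ρ₀ a : ℝ) : ENNReal :=
  ENNReal.ofReal (1 / a) * sSup {z : ENNReal | ∃ (x : M) (w : Ω), ρ x ≤ ρ₀ ∧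
    z = ENNReal.ofReal
      (max 0 (-(inner ℝ (riemGrad ρ x : TangentSpace (𝓡 m) x) (gradM f x w))))}

/-- `B = (1/b) sup { √max{0, Hess(ρ ∘ R_x)|_{θ ∇_M f(x,ω)}(∇_M f(x,ω), ∇_M f(x,ω))} |
|θ| ≤ Θ, ρ(x) ≤ ρ₁, ω ∈ Ω }`, the supremum being taken in `[0, ∞]`. -/
def constB (R : TangentBundle (𝓡 m) M → M) (f : M → Ω → ℝ) (ρ : M → ℝ) (ρ₁ b Θ : ℝ) : ENNReal :=
  ENNReal.ofReal (1 / b) * sSup {z : ENNReal | ∃ (θ : ℝ) (x : M) (w : Ω),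
    |θ| ≤ Θ ∧ ρ x ≤ ρ₁ ∧
    z = ENNReal.ofReal (Real.sqrt (max 0
      (hessian (fun u : TangentSpace (𝓡 m) x => ρ (restrictFiber R x u))
        (θ • gradM f x w) (gradM f x w) (gradM f x w))))}

/-- The stochastic gradient descent `x_{t+1} = R_{x_t}(-(c_t/φ) ∇_M f(x_t, ω_t))` started at `x₀`,
driven by the samples `ω_t = ξ t : S → Ω`. -/
def sgdIterate {S : Type*} (R : TangentBundle (𝓡 m) M → M) (f : M → Ω → ℝ) (c : ℕ → ℝ) (φ : ℝ)
    (ξ : ℕ → S → Ω) (x₀ : M) : ℕ → S → M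
  | 0, _ => x₀
  | t + 1, s =>
    restrictFiber R (sgdIterate R f c φ ξ x₀ t s)
      (-(c t / φ) • gradM f (sgdIterate R f c φ ξ x₀ t s) (ξ t s))

variable (m) in
/-- `y` is a stationary point of `g`: `g` is differentiable at `y` with vanishing gradient. -/
def IsStationaryPoint (g : M → ℝ) (y : M) : Prop :=
  MDifferentiableAt (𝓡 m) 𝓘(ℝ, ℝ) g y ∧ (riemGrad g y : TangentSpace (𝓡 m) y) = 0

end RiemannianSGD

/-! Confinement is deterministic. A second-order expansion of ρ ∘ R_x along -∇_M f bounds the rise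
of ρ in one step by -(c_t/φ)⟨∇ρ, ∇_M f⟩ + b²c_t²/2, since B ≤ φ bounds the Hessian by (bφ)². Where ρ
≥ ρ₀ the first term is nonpositive; where ρ ≤ ρ₀ it is at most c_t a, since A ≤ φ. By induction
ρ(x_t) ≤ ρ₀ + ca + (b²/2) ∑_{i<t} c_i² (`IsRetraction.confinement_step`).

The mean F inherits the estimates on f ∘ R_x, and ∇F is the mean of ∇_M f. A fresh sample therefore
lowers F in conditional mean by (c_t/φ)‖∇F‖², up to an error O(c_t²) (`integral_descentStep_le`).
Adding the past decreases to F(x_t) and subtracting the past errors gives an L¹-bounded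
supermartingale, so almost surely F(x_t) converges and ∑ c_t‖∇F(x_t)‖² is finite
(`ae_tendsto_and_summable_of_setIntegral_le`).

With ∑ c_t = ∞ this gives at once only that the lower limit of ‖∇F(x_t)‖ is zero. If ‖∇F‖² > ε on
the support of a bump function around a limit point, the truncated bump has finite total variation
along the sequence, because steps have size O(c_t). It returns to 1 infinitely often, so the
sequence stays in the support from some time on and ∑ c_t is finite, a contradiction
(`IsRetraction.eq_zero_of_mapClusterPt`). Only continuity of ‖∇F‖ enters, no Lipschitz bound between
base points. Compactness then yields ‖∇F(x_t)‖ → 0. -/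

open Filter Set MeasureTheory ProbabilityTheory

/-! ### Retractions as local parametrizations -/

section Retraction

variable {m : ℕ} {M : Type*} [TopologicalSpace M]
  [ChartedSpace (EuclideanSpace ℝ (Fin m)) M] [IsManifold (𝓡 m) ∞ M]
  [Bundle.RiemannianBundle (fun x : M => TangentSpace (𝓡 m) x)]

/-- In the trivialization at `x`, the inclusion of the fibre over `x` is constant in the base and
linear in the fibre. -/
lemma contMDiff_tangentMk (x : M) :
    ContMDiff 𝓘(ℝ, TangentSpace (𝓡 m) x) (𝓡 m).tangent ∞
      (fun v : TangentSpace (𝓡 m) x => (⟨x, v⟩ : TangentBundle (𝓡 m) M)) := by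
  intro v
  rw [Bundle.contMDiffAt_totalSpace]
  refine ⟨contMDiffAt_const, ?_⟩
  have h : (fun v : TangentSpace (𝓡 m) x =>
      (trivializationAt (EuclideanSpace ℝ (Fin m)) (TangentSpace (𝓡 m)) x
        (⟨x, v⟩ : TangentBundle (𝓡 m) M)).2) =
      (trivializationAt (EuclideanSpace ℝ (Fin m)) (TangentSpace (𝓡 m)) x).continuousLinearMapAt
        ℝ x := by
    ext1 v
    rw [Bundle.Trivialization.continuousLinearMapAt_apply,
      Bundle.Trivialization.linearMapAt_apply, if_pos (mem_baseSet_trivializationAt _ _ x)]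
  rw [h]
  exact (ContinuousLinearMap.contDiff _).contMDiff.contMDiffAt

lemma contMDiff_restrictFiber {R : TangentBundle (𝓡 m) M → M} {n : WithTop ℕ∞} (hn : n ≤ ∞)
    (hR : ContMDiff (𝓡 m).tangent (𝓡 m) n R) (x : M) :
    ContMDiff 𝓘(ℝ, TangentSpace (𝓡 m) x) (𝓡 m) n (restrictFiber R x) :=
  hR.comp ((contMDiff_tangentMk x).of_le hn)

omit [IsManifold (𝓡 m) ∞ M] [Bundle.RiemannianBundle (fun x : M => TangentSpace (𝓡 m) x)] in
-- Absorbs the cast in `IsRetraction.mfderiv_zero`: R_x(0) = x is not definitional, so the base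
-- point is changed by substitution.
lemma mfderiv_cast_tangent {E' : Type*} [NormedAddCommGroup E'] [NormedSpace ℝ E']
    (h : M → E') {x y : M} (e : y = x) (w : TangentSpace (𝓡 m) y) :
    (mfderiv (𝓡 m) 𝓘(ℝ, E') h y w : E') = mfderiv (𝓡 m) 𝓘(ℝ, E') h x
      (cast (congrArg (fun y : M => TangentSpace (𝓡 m) y) e) w) := by
  subst e; rfl

/-- Continuous linear maps between normed spaces, with the topologies given by the norms. -/
abbrev NormedMap (V W : Type*) [NormedAddCommGroup V] [NormedSpace ℝ V] [NormedAddCommGroup W]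
    [NormedSpace ℝ W] : Type _ := V →L[ℝ] W

/-- The differential of a map from a manifold to a normed space, with values in that space. -/
noncomputable def differential {E' : Type*} [NormedAddCommGroup E'] [NormedSpace ℝ E']
    (h : M → E') (x : M) : NormedMap (TangentSpace (𝓡 m) x) E' :=
  mfderiv (𝓡 m) 𝓘(ℝ, E') h x

/-- The differential of the restriction `R_x` of a map `R : TM → M`. -/
noncomputable def fiberDifferential (R : TangentBundle (𝓡 m) M → M) (x : M)
    (v : TangentSpace (𝓡 m) x) :
    NormedMap (TangentSpace (𝓡 m) x) (TangentSpace (𝓡 m) (restrictFiber R x v)) :=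
  mfderiv 𝓘(ℝ, TangentSpace (𝓡 m) x) (𝓡 m) (restrictFiber R x) v

namespace IsRetraction

variable {R : TangentBundle (𝓡 m) M → M}

lemma mdifferentiable_restrictFiber (hR : IsRetraction R) (x : M) :
    MDifferentiable 𝓘(ℝ, TangentSpace (𝓡 m) x) (𝓡 m) (restrictFiber R x) :=
  (contMDiff_restrictFiber (by norm_num) hR.contMDiff x).mdifferentiable one_ne_zero

lemma hasFDerivAt_comp {E' : Type*} [NormedAddCommGroup E'] [NormedSpace ℝ E']
    (hR : IsRetraction R) {h : M → E'} (x : M) (v : TangentSpace (𝓡 m) x)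
    (hh : MDifferentiableAt (𝓡 m) 𝓘(ℝ, E') h (restrictFiber R x v)) :
    HasFDerivAt (fun u : TangentSpace (𝓡 m) x => h (restrictFiber R x u))
      ((differential (m := m) h (restrictFiber R x v)).comp
        (fiberDifferential R x v)) v :=
  (hh.hasMFDerivAt.comp v (hR.mdifferentiable_restrictFiber x v).hasMFDerivAt).hasFDerivAt

lemma hasFDerivAt_comp_zero {E' : Type*} [NormedAddCommGroup E'] [NormedSpace ℝ E']
    (hR : IsRetraction R) {h : M → E'} (x : M) (hh : MDifferentiableAt (𝓡 m) 𝓘(ℝ, E') h x) :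
    HasFDerivAt (𝕜 := ℝ) (fun u : TangentSpace (𝓡 m) x => h (restrictFiber R x u))
      (differential (m := m) h x) 0 := by
  have h1 := hR.hasFDerivAt_comp (h := h) x 0 (by rw [hR.map_zero]; exact hh)
  refine h1.congr_fderiv ?_
  ext v
  have := mfderiv_cast_tangent h (hR.map_zero x)
    (mfderiv 𝓘(ℝ, TangentSpace (𝓡 m) x) (𝓡 m) (restrictFiber R x) 0 v)
  rw [hR.mfderiv_zero] at this
  exact this

lemma contDiffAt_chart (hR : IsRetraction R) (x : M) : ContDiffAt ℝ 1
    (fun u : TangentSpace (𝓡 m) x => extChartAt (𝓡 m) x (restrictFiber R x u)) 0 := by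
  rw [← contMDiffAt_iff_contDiffAt]
  refine ContMDiffAt.comp (I' := 𝓡 m) 0 ?_
    (contMDiff_restrictFiber (by norm_num) hR.contMDiff x).contMDiffAt
  rw [hR.map_zero]
  exact contMDiffAt_extChartAt (n := 1)

/-- A retraction read in the chart at the base point is a local diffeomorphism at zero. -/
lemma exists_hasStrictFDerivAt_chart (hR : IsRetraction R) (x : M) :
    ∃ A : TangentSpace (𝓡 m) x ≃L[ℝ] EuclideanSpace ℝ (Fin m), HasStrictFDerivAt
      (fun u : TangentSpace (𝓡 m) x => extChartAt (𝓡 m) x (restrictFiber R x u))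
      (A : TangentSpace (𝓡 m) x →L[ℝ] EuclideanSpace ℝ (Fin m)) 0 := by
  have hd := hR.hasFDerivAt_comp_zero (h := extChartAt (𝓡 m) x) x
    (mdifferentiableAt_extChartAt (mem_chart_source _ x))
  obtain ⟨A, hA⟩ := isInvertible_mfderiv_extChartAt (I := 𝓡 m) (mem_extChartAt_source (I := 𝓡 m) x)
  refine ⟨A, ?_⟩
  refine ((hR.contDiffAt_chart x).hasStrictFDerivAt' ?_ one_ne_zero)
  refine hd.congr_fderiv ?_
  exact hA.symm

end IsRetraction
end Retraction

/-! ### Continuity of gradients from pullbacks along the retraction -/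

section GradientContinuity

variable {m : ℕ} {M : Type*} [TopologicalSpace M]
  [ChartedSpace (EuclideanSpace ℝ (Fin m)) M] [IsManifold (𝓡 m) ∞ M]
  [Bundle.RiemannianBundle (fun x : M => TangentSpace (𝓡 m) x)]

variable {R : TangentBundle (𝓡 m) M → M}

omit [Bundle.RiemannianBundle (fun x : M => TangentSpace (𝓡 m) x)] in
lemma differentiableAt_comp_extChartAt_symm {h : M → ℝ} (hh : MDifferentiable (𝓡 m) 𝓘(ℝ, ℝ) h)
    (x : M) {z : EuclideanSpace ℝ (Fin m)} (hz : z ∈ (extChartAt (𝓡 m) x).target) :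
    DifferentiableAt ℝ (h ∘ (extChartAt (𝓡 m) x).symm) z := by
  have h1 : MDifferentiableAt 𝓘(ℝ, EuclideanSpace ℝ (Fin m)) (𝓡 m) (extChartAt (𝓡 m) x).symm z := by
    have := mdifferentiableWithinAt_extChartAt_symm (I := 𝓡 m) hz
    rwa [show range (𝓡 m) = univ by simp, mdifferentiableWithinAt_univ] at this
  exact ((hh _).comp z h1).differentiableAt

namespace IsRetraction

lemma eventually_mem_chart_source (hR : IsRetraction R) (x : M) :
    ∀ᶠ u : TangentSpace (𝓡 m) x in 𝓝 0, restrictFiber R x u ∈ (extChartAt (𝓡 m) x).source := by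
  have hc := (hR.mdifferentiable_restrictFiber x).continuous.continuousAt (x := 0)
  refine hc.eventually ?_
  rw [hR.map_zero]
  exact extChartAt_source_mem_nhds x

/-- If `h ∘ R_x` has a derivative continuous at zero, then the derivative of `h` read in the chart
at `x` is continuous at `x`. -/
lemma continuousAt_fderiv_chart (hR : IsRetraction R) {h : M → ℝ}
    (hh : MDifferentiable (𝓡 m) 𝓘(ℝ, ℝ) h) (x : M)
    (hc : ContinuousAt (fderiv ℝ (fun u : TangentSpace (𝓡 m) x => h (restrictFiber R x u))) 0) :
    ContinuousAt (fderiv ℝ (h ∘ (extChartAt (𝓡 m) x).symm)) (extChartAt (𝓡 m) x x) := by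
  obtain ⟨A, hA⟩ := hR.exists_hasStrictFDerivAt_chart x
  set G := fun u : TangentSpace (𝓡 m) x => extChartAt (𝓡 m) x (restrictFiber R x u) with hG
  have hG0 : G 0 = extChartAt (𝓡 m) x x := by simp only [hG, hR.map_zero]
  have hGc : ContDiffAt ℝ 1 G 0 := hR.contDiffAt_chart x
  have hmap := hA.map_nhds_eq_of_equiv
  -- `G` maps the neighbourhoods of 0 onto those of `G 0`, so the limit can be taken over tangent
  -- vectors. There the chain rule `hev` expresses the chart derivative by the derivative of h ∘ R_x
  -- and the inverse of that of `G`.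
  rw [← hG0, ContinuousAt, ← hmap, tendsto_map'_iff]
  have hdG : ContinuousAt (fderiv ℝ G) 0 := hGc.continuousAt_fderiv one_ne_zero
  have hinv : ContinuousAt (fun u => (fderiv ℝ G u).inverse) 0 := by
    have h2 : ContinuousAt ContinuousLinearMap.inverse (fderiv ℝ G 0) := by
      rw [hA.hasFDerivAt.fderiv]
      exact (contDiffAt_map_inverse (n := 0) A).continuousAt
    exact h2.comp hdG
  have hev : ∀ᶠ u in 𝓝 (0 : TangentSpace (𝓡 m) x), (fderiv ℝ (h ∘ (extChartAt (𝓡 m) x).symm) ∘ G) u =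
      (fderiv ℝ (fun u : TangentSpace (𝓡 m) x => h (restrictFiber R x u)) u).comp
        ((fderiv ℝ G u).inverse) := by
    have e1 := (hR.eventually_mem_chart_source x).eventually_nhds
    have e2 : ∀ᶠ u in 𝓝 (0 : TangentSpace (𝓡 m) x), (fderiv ℝ G u).IsInvertible := by
      have : ∀ᶠ T in 𝓝 (fderiv ℝ G 0), T.IsInvertible := by
        rw [hA.hasFDerivAt.fderiv]
        exact A.nhds
      exact hdG.eventually this
    have e3 : ∀ᶠ u in 𝓝 (0 : TangentSpace (𝓡 m) x), DifferentiableAt ℝ G u :=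
      (hGc.eventually (by simp)).mono fun u hu => hu.differentiableAt one_ne_zero
    filter_upwards [e1, e2, e3] with u h1 h2 h3
    have heq : (fun u : TangentSpace (𝓡 m) x => h (restrictFiber R x u)) =ᶠ[𝓝 u]
        (h ∘ (extChartAt (𝓡 m) x).symm) ∘ G := by
      filter_upwards [h1] with w hw
      simp only [hG, Function.comp_apply, (extChartAt (𝓡 m) x).left_inv hw]
    rw [heq.fderiv_eq, fderiv_comp u
      (differentiableAt_comp_extChartAt_symm hh x ((extChartAt (𝓡 m) x).map_source h1.self_of_nhds))
      h3]
    obtain ⟨B, hB⟩ := h2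
    rw [← hB]
    ext e
    simp
  refine Tendsto.congr' (EventuallyEq.symm hev) ?_
  have h4 := hc.clm_comp hinv
  have h5 : fderiv ℝ (h ∘ (extChartAt (𝓡 m) x).symm) (G 0) =
    (fderiv ℝ (fun u : TangentSpace (𝓡 m) x => h (restrictFiber R x u)) 0).comp
        ((fderiv ℝ G 0).inverse) := hev.self_of_nhds
  rw [h5]
  exact h4

end IsRetraction


omit [IsManifold (𝓡 m) ∞ M] in
lemma inner_riemGrad (h : M → ℝ) (x : M) (v : TangentSpace (𝓡 m) x) :
    inner ℝ (riemGrad h x) v = differential (m := m) h x v := by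
  rw [riemGrad]
  exact InnerProductSpace.toDual_symm_apply (𝕜 := ℝ)

/-- The differential, applied to a vector in the trivialization at `x`, is the derivative in the
chart at `x`. -/
lemma differential_symm_trivializationAt {h : M → ℝ} (hh : MDifferentiable (𝓡 m) 𝓘(ℝ, ℝ) h)
    {x y : M} (hy : y ∈ (chartAt (EuclideanSpace ℝ (Fin m)) x).source)
    (e : EuclideanSpace ℝ (Fin m)) :
    differential (m := m) h y
      ((trivializationAt (EuclideanSpace ℝ (Fin m)) (TangentSpace (𝓡 m)) x).symm y e) =
    fderiv ℝ (h ∘ (extChartAt (𝓡 m) x).symm) (extChartAt (𝓡 m) x y) e := by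
  have hy' : y ∈ (extChartAt (𝓡 m) x).source := by rwa [extChartAt_source]
  have h1 : MDifferentiableAt 𝓘(ℝ, EuclideanSpace ℝ (Fin m)) (𝓡 m) (extChartAt (𝓡 m) x).symm
      (extChartAt (𝓡 m) x y) := by
    have := mdifferentiableWithinAt_extChartAt_symm (I := 𝓡 m) ((extChartAt (𝓡 m) x).map_source hy')
    rwa [show range (𝓡 m) = univ by simp, mdifferentiableWithinAt_univ] at this
  have h2 := TangentBundle.symmL_trivializationAt (I := 𝓡 m) (𝕜 := ℝ) hy
  rw [show range (𝓡 m) = univ by simp, mfderivWithin_univ] at h2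
  let D : EuclideanSpace ℝ (Fin m) →L[ℝ]
      TangentSpace (𝓡 m) ((extChartAt (𝓡 m) x).symm (extChartAt (𝓡 m) x y)) :=
    mfderiv 𝓘(ℝ, EuclideanSpace ℝ (Fin m)) (𝓡 m) (extChartAt (𝓡 m) x).symm (extChartAt (𝓡 m) x y)
  have h3 : HasFDerivAt (h ∘ (extChartAt (𝓡 m) x).symm)
      ((differential (m := m) h ((extChartAt (𝓡 m) x).symm (extChartAt (𝓡 m) x y))).comp D)
      (extChartAt (𝓡 m) x y) :=
    ((hh _).hasMFDerivAt.comp _ h1.hasMFDerivAt).hasFDerivAt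
  have h5 : ∀ {y' : M} (_ : y' = y) (w : EuclideanSpace ℝ (Fin m)),
      differential (m := m) h y' w = differential (m := m) h y w := by
    rintro _ rfl w; rfl
  rw [h3.fderiv]
  refine Eq.trans ?_ (h5 ((extChartAt (𝓡 m) x).left_inv hy') _).symm
  refine congrArg (differential (m := m) h y) ?_
  have h6 := DFunLike.congr_fun h2 e
  rw [Bundle.Trivialization.symmL_apply _ hy] at h6
  exact h6

/-- In coordinates the gradient is the inverse Gram matrix of the metric applied to the
differential, and both factors are continuous at `x`. -/
lemma continuousAt_riemGrad_of_chart
    [IsContinuousRiemannianBundle (EuclideanSpace ℝ (Fin m)) (fun x : M => TangentSpace (𝓡 m) x)]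
    {h : M → ℝ} (hh : MDifferentiable (𝓡 m) 𝓘(ℝ, ℝ) h) (x : M)
    (hc : ContinuousAt (fderiv ℝ (h ∘ (extChartAt (𝓡 m) x).symm)) (extChartAt (𝓡 m) x x)) :
    ContinuousAt (fun y : M => (⟨y, riemGrad h y⟩ : TangentBundle (𝓡 m) M)) x := by
  rw [FiberBundle.continuousAt_totalSpace]
  refine ⟨continuousAt_id, ?_⟩
  obtain ⟨g, g_cont, hg⟩ := IsContinuousRiemannianBundle.exists_continuous
    (F := EuclideanSpace ℝ (Fin m)) (E := fun x : M => TangentSpace (𝓡 m) x)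
  set e := trivializationAt (EuclideanSpace ℝ (Fin m)) (TangentSpace (𝓡 m)) x with he
  -- The metric at `y` as a bilinear form on the model space, read in the trivialization at `x`.
  -- Positive definiteness and finite dimension make it invertible at `x`, hence nearby.
  let g' : M → EuclideanSpace ℝ (Fin m) →L[ℝ] EuclideanSpace ℝ (Fin m) →L[ℝ] ℝ := fun y ↦
    ContinuousLinearMap.inCoordinates (EuclideanSpace ℝ (Fin m)) (fun x : M => TangentSpace (𝓡 m) x)
      (EuclideanSpace ℝ (Fin m) →L[ℝ] ℝ)
      (fun x : M ↦ TangentSpace (𝓡 m) x →L[ℝ] ℝ) x y x y (g y)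
  have hg' : ContinuousAt g' x := by
    have W := g_cont.continuousAt (x := x)
    simp only [continuousAt_hom_bundle] at W
    exact W.2
  have hg'_apply : ∀ y ∈ e.baseSet, ∀ u v, g' y u v = inner ℝ (e.symm y u) (e.symm y v) := by
    intro y hy u v
    rw [hg]
    have := inCoordinates_apply_eq₂ (ϕ := g y) (v := u) (w := v) (x₀ := x)
      (F₃ := ℝ) (E₃ := Bundle.Trivial M ℝ) hy hy (Set.mem_univ _)
    refine this.trans ?_
    simp
    rfl
  have hx : x ∈ e.baseSet := mem_baseSet_trivializationAt _ _ x
  have hinj : Function.Injective (g' x) := by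
    rw [injective_iff_map_eq_zero]
    intro u hu
    have h1 := hg'_apply x hx u u
    rw [hu] at h1
    have h2 : e.symm x u = 0 := inner_self_eq_zero.1 h1.symm
    have := (e.continuousLinearEquivAt ℝ x hx).symm.map_eq_zero_iff.1 h2
    exact this
  obtain ⟨A, hA⟩ : (g' x).IsInvertible := by
    have hfr : Module.finrank ℝ (EuclideanSpace ℝ (Fin m)) =
        Module.finrank ℝ (EuclideanSpace ℝ (Fin m) →L[ℝ] ℝ) :=
      LinearEquiv.finrank_eq (InnerProductSpace.toDual ℝ (EuclideanSpace ℝ (Fin m))).toLinearEquiv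
    exact ⟨(LinearEquiv.ofInjectiveOfFinrankEq (g' x).toLinearMap hinj hfr).toContinuousLinearEquiv,
      by ext; rfl⟩
  have hinv : ContinuousAt (fun y => (g' y).inverse) x := by
    have h2 : ContinuousAt ContinuousLinearMap.inverse (g' x) := by
      rw [← hA]
      exact (contDiffAt_map_inverse (n := 0) A).continuousAt
    exact h2.comp hg'
  have hd : ContinuousAt (fun y => fderiv ℝ (h ∘ (extChartAt (𝓡 m) x).symm)
      (extChartAt (𝓡 m) x y)) x :=
    ContinuousAt.comp (g := fderiv ℝ (h ∘ (extChartAt (𝓡 m) x).symm)) hc (continuousAt_extChartAt x)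
  refine (hinv.clm_apply hd).congr ?_
  have e2 : ∀ᶠ y in 𝓝 x, (g' y).IsInvertible := by
    refine hg'.eventually (p := fun T => T.IsInvertible) ?_
    rw [← hA]
    exact A.nhds
  filter_upwards [e2, e.open_baseSet.mem_nhds hx] with y hB hy
  obtain ⟨B, hB⟩ := hB
  rw [← hB, ContinuousLinearMap.inverse_equiv]
  refine (B.symm_apply_eq).2 ?_
  ext u
  have hB' : ∀ w, B w = g' y w := fun w => DFunLike.congr_fun hB w
  rw [hB', hg'_apply y hy, ← differential_symm_trivializationAt hh hy, ← inner_riemGrad]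
  congr 1
  exact (e.symm_apply_apply_mk hy _).symm

/-- A differentiable function whose pullbacks `h ∘ R_x` have derivatives continuous at zero has a
continuous gradient. -/
lemma IsRetraction.continuous_riemGrad
    [IsContinuousRiemannianBundle (EuclideanSpace ℝ (Fin m)) (fun x : M => TangentSpace (𝓡 m) x)]
    (hR : IsRetraction R) {h : M → ℝ} (hh : MDifferentiable (𝓡 m) 𝓘(ℝ, ℝ) h)
    (hc : ∀ x : M, ContinuousAt
      (fderiv ℝ (fun u : TangentSpace (𝓡 m) x => h (restrictFiber R x u))) 0) :
    Continuous (fun y : M => (⟨y, riemGrad h y⟩ : TangentBundle (𝓡 m) M)) :=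
  continuous_iff_continuousAt.2 fun x =>
    continuousAt_riemGrad_of_chart hh x (hR.continuousAt_fderiv_chart hh x (hc x))

/-- Differentiability at `x` can be tested after composition with `R_x`. -/
lemma IsRetraction.mdifferentiableAt_of_comp (hR : IsRetraction R) {h : M → ℝ} (x : M)
    (hd : DifferentiableAt ℝ (fun u : TangentSpace (𝓡 m) x => h (restrictFiber R x u)) 0) :
    MDifferentiableAt (𝓡 m) 𝓘(ℝ, ℝ) h x := by
  obtain ⟨A, hA⟩ := hR.exists_hasStrictFDerivAt_chart x
  set G := fun u : TangentSpace (𝓡 m) x => extChartAt (𝓡 m) x (restrictFiber R x u) with hG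
  have hG0 : G 0 = extChartAt (𝓡 m) x x := by simp only [hG, hR.map_zero]
  let L := hA.localInverse G A 0
  have hL : HasFDerivAt L (A.symm : EuclideanSpace ℝ (Fin m) →L[ℝ] TangentSpace (𝓡 m) x) (G 0) :=
    hA.to_localInverse.hasFDerivAt
  have hL0 : L (G 0) = 0 := hA.localInverse_apply_image
  have hLt : Tendsto L (𝓝 (G 0)) (𝓝 0) := by
    have := hL.continuousAt; rwa [ContinuousAt, hL0] at this
  have hdiff : DifferentiableAt ℝ
      ((fun u : TangentSpace (𝓡 m) x => h (restrictFiber R x u)) ∘ L) (G 0) :=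
    DifferentiableAt.comp _ (by rw [hL0]; exact hd) hL.differentiableAt
  have hmd : MDifferentiableAt (𝓡 m) 𝓘(ℝ, ℝ)
      (((fun u : TangentSpace (𝓡 m) x => h (restrictFiber R x u)) ∘ L) ∘ extChartAt (𝓡 m) x) x := by
    refine MDifferentiableAt.comp (I' := 𝓘(ℝ, EuclideanSpace ℝ (Fin m))) x ?_
      (mdifferentiableAt_extChartAt (mem_chart_source _ x))
    rw [← hG0]
    exact hdiff.mdifferentiableAt
  refine hmd.congr_of_eventuallyEq ?_
  have e1 : ∀ᶠ y in 𝓝 x, G (L (extChartAt (𝓡 m) x y)) = extChartAt (𝓡 m) x y := by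
    have := hA.eventually_right_inverse
    rw [hG0] at this
    exact (continuousAt_extChartAt x).eventually this
  have e2 : ∀ᶠ y in 𝓝 x,
      restrictFiber R x (L (extChartAt (𝓡 m) x y)) ∈ (extChartAt (𝓡 m) x).source := by
    have := hLt.eventually (hR.eventually_mem_chart_source x)
    rw [hG0] at this
    exact (continuousAt_extChartAt x).eventually this
  filter_upwards [e1, e2, extChartAt_source_mem_nhds (I := 𝓡 m) x] with y h1 h2 h3
  have h4 : restrictFiber R x (L (extChartAt (𝓡 m) x y)) = y := (extChartAt (𝓡 m) x).injOn h2 h3 h1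
  simp only [Function.comp_apply, h4]

end GradientContinuity

/-! ### Displacement of a function by a step along the retraction -/

section StepBound

variable {m : ℕ} {M : Type*} [TopologicalSpace M]
  [ChartedSpace (EuclideanSpace ℝ (Fin m)) M] [IsManifold (𝓡 m) ∞ M]
  [Bundle.RiemannianBundle (fun x : M => TangentSpace (𝓡 m) x)]
  [IsContinuousRiemannianBundle (EuclideanSpace ℝ (Fin m)) (fun x : M => TangentSpace (𝓡 m) x)]

/-- A `C^1` function on the tangent bundle is Lipschitz along the fibers near the zero section. -/
lemma exists_abs_sub_zero_le_of_contMDiff {Q : TangentBundle (𝓡 m) M → ℝ}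
    (hQ : ContMDiff (𝓡 m).tangent 𝓘(ℝ, ℝ) 1 Q) (x₀ : M) :
    ∃ δ > 0, ∃ C > 0, ∀ᶠ y in 𝓝 x₀, ∀ v : TangentSpace (𝓡 m) y, ‖v‖ ≤ δ →
      |Q ⟨y, v⟩ - Q ⟨y, 0⟩| ≤ C * ‖v‖ := by
  set E := EuclideanSpace ℝ (Fin m)
  set p₀ : TangentBundle (𝓡 m) M := ⟨x₀, 0⟩ with hp₀
  have h1 := (contMDiffAt_iff.1 (hQ p₀)).2
  rw [show range ((𝓡 m).tangent) = univ by
    simp [ModelWithCorners.tangent, modelWithCorners_prod_coe], contDiffWithinAt_univ] at h1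
  obtain ⟨L, U, hU, hLip⟩ := h1.exists_lipschitzOnWith
  set e := trivializationAt E (TangentSpace (𝓡 m)) x₀ with he
  -- In the bundle chart, `v` affects only the fibre coordinate, and linearly. So `⟨y, v⟩` and `⟨y,
  -- 0⟩` are at coordinate distance at most C‖v‖.
  have hchart : ∀ y ∈ (extChartAt (𝓡 m) x₀).source, ∀ v : TangentSpace (𝓡 m) y,
      (⟨y, v⟩ : TangentBundle (𝓡 m) M) ∈ (extChartAt (𝓡 m).tangent p₀).source ∧
      extChartAt (𝓡 m).tangent p₀ ⟨y, v⟩ =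
        (extChartAt (𝓡 m) x₀ y, e.continuousLinearMapAt ℝ y v) := by
    intro y hy v
    have hy' : y ∈ e.baseSet := by rwa [extChartAt_source] at hy
    have hv : (⟨y, v⟩ : TangentBundle (𝓡 m) M) ∈ e.source := e.mem_source.2 hy'
    have hL : e.continuousLinearMapAt ℝ y v = (e ⟨y, v⟩).2 := by
      rw [Bundle.Trivialization.continuousLinearMapAt_apply,
        Bundle.Trivialization.linearMapAt_apply, if_pos hy']
    have hfst : (e ⟨y, v⟩).1 = y := e.coe_fst hv
    rw [hL, show extChartAt (𝓡 m).tangent p₀ = _ from FiberBundle.extChartAt p₀]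
    refine ⟨⟨hv, ?_, mem_univ _⟩, ?_⟩
    · change (e ⟨y, v⟩).1 ∈ _
      rw [hfst]; exact hy
    · change (extChartAt (𝓡 m) x₀ (e ⟨y, v⟩).1, (e ⟨y, v⟩).2) = _
      rw [hfst]
  obtain ⟨C, hC, hCev⟩ := eventually_norm_trivializationAt_lt E
    (fun x : M => TangentSpace (𝓡 m) x) x₀
  rw [(hchart x₀ (mem_extChartAt_source _) 0).2, map_zero] at hU
  obtain ⟨U₁, hU₁, U₂, hU₂, hUU⟩ := mem_nhds_prod_iff.1 hU
  obtain ⟨r, hr, hrU⟩ := Metric.nhds_basis_closedBall.mem_iff.1 hU₂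
  -- `C` bounds the trivialization near `x₀`, so ‖v‖ ≤ r / C keeps the fibre coordinate in the ball
  -- of radius `r`, where `L` is a Lipschitz constant. The added 1 only makes the constant positive.
  refine ⟨r / C, by positivity, L * C + 1, by positivity, ?_⟩
  filter_upwards [hCev, extChartAt_source_mem_nhds (I := 𝓡 m) x₀,
    (continuousAt_extChartAt (I := 𝓡 m) x₀).preimage_mem_nhds hU₁] with y hy1 hy2 hy3 v hv
  have hn : ‖e.continuousLinearMapAt ℝ y v‖ ≤ C * ‖v‖ :=
    ((e.continuousLinearMapAt ℝ y).le_opNorm v).trans (by gcongr)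
  have m1 : (extChartAt (𝓡 m) x₀ y, e.continuousLinearMapAt ℝ y v) ∈ U := by
    refine hUU ⟨hy3, hrU ?_⟩
    rw [mem_closedBall_zero_iff]
    calc _ ≤ C * ‖v‖ := hn
      _ ≤ C * (r / C) := by gcongr
      _ = r := by field_simp
  have m0 : (extChartAt (𝓡 m) x₀ y, (0 : E)) ∈ U :=
    hUU ⟨hy3, hrU (Metric.mem_closedBall_self hr.le)⟩
  have h2 := hLip.dist_le_mul _ m1 _ m0
  obtain ⟨s1, c1⟩ := hchart y hy2 v
  obtain ⟨s0, c0⟩ := hchart y hy2 0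
  rw [map_zero] at c0
  have e1 := (extChartAt (𝓡 m).tangent p₀).left_inv s1
  have e0 := (extChartAt (𝓡 m).tangent p₀).left_inv s0
  rw [c1] at e1
  rw [c0] at e0
  simp only [Function.comp_apply, e1, e0, Prod.dist_eq, dist_self, dist_zero_right,
    extChartAt_model_space_eq_id, PartialEquiv.refl_coe, id, Real.dist_eq] at h2
  rw [max_eq_right (norm_nonneg _)] at h2
  calc _ ≤ L * ‖e.continuousLinearMapAt ℝ y v‖ := h2
    _ ≤ L * (C * ‖v‖) := by gcongr
    _ ≤ (L * C + 1) * ‖v‖ := by nlinarith [norm_nonneg v]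

lemma IsRetraction.exists_abs_sub_le {R : TangentBundle (𝓡 m) M → M} (hR : IsRetraction R)
    {ψ : M → ℝ} (hψ : ContMDiff (𝓡 m) 𝓘(ℝ, ℝ) 1 ψ) {K : Set M} (hK : IsCompact K) :
    ∃ δ > 0, ∃ C > 0, ∀ y ∈ K, ∀ v : TangentSpace (𝓡 m) y, ‖v‖ ≤ δ →
      |ψ (restrictFiber R y v) - ψ y| ≤ C * ‖v‖ := by
  refine hK.induction_on (p := fun K => ∃ δ > 0, ∃ C > 0, ∀ y ∈ K, ∀ v : TangentSpace (𝓡 m) y,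
    ‖v‖ ≤ δ → |ψ (restrictFiber R y v) - ψ y| ≤ C * ‖v‖) ⟨1, one_pos, 1, one_pos, by simp⟩ ?_ ?_ ?_
  · rintro s t hst ⟨δ, hδ, C, hC, h⟩
    exact ⟨δ, hδ, C, hC, fun y hy => h y (hst hy)⟩
  · rintro s t ⟨δ, hδ, C, hC, h⟩ ⟨δ', hδ', C', hC', h'⟩
    refine ⟨min δ δ', lt_min hδ hδ', max C C', lt_max_of_lt_left hC, ?_⟩
    rintro y (hy | hy) v hv
    · exact (h y hy v (hv.trans (min_le_left _ _))).trans (by gcongr; exact le_max_left _ _)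
    · exact (h' y hy v (hv.trans (min_le_right _ _))).trans (by gcongr; exact le_max_right _ _)
  · intro x _
    obtain ⟨δ, hδ, C, hC, h⟩ := exists_abs_sub_zero_le_of_contMDiff (hψ.comp hR.contMDiff) x
    refine ⟨_, mem_nhdsWithin_of_mem_nhds h, δ, hδ, C, hC, fun y hy v hv => ?_⟩
    have h1 := hy v hv
    have h2 := hR.map_zero y
    simp only [restrictFiber, Function.comp_apply] at h1 h2 ⊢
    rwa [h2] at h1

end StepBound

/-! ### Taylor estimates and differentiation under the integral -/

section RandomFunction

variable {m : ℕ} {M : Type*} [TopologicalSpace M]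
  [ChartedSpace (EuclideanSpace ℝ (Fin m)) M] [IsManifold (𝓡 m) ∞ M]
  [Bundle.RiemannianBundle (fun x : M => TangentSpace (𝓡 m) x)]

variable {R : TangentBundle (𝓡 m) M → M} {Ω : Type*} {f : M → Ω → ℝ}

lemma norm_gradient_sub_gradient {V : Type*} [NormedAddCommGroup V] [InnerProductSpace ℝ V]
    [CompleteSpace V] (g : V → ℝ) (v w : V) :
    ‖gradient g v - gradient g w‖ = ‖fderiv ℝ g v - fderiv ℝ g w‖ := by
  rw [gradient, gradient, ← map_sub, LinearIsometryEquiv.norm_map]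

omit [IsManifold (𝓡 m) ∞ M] in
lemma norm_riemGrad (h : M → ℝ) (x : M) : ‖(riemGrad h x : TangentSpace (𝓡 m) x)‖ =
    ‖differential (m := m) h x‖ := by
  rw [riemGrad]
  exact LinearIsometryEquiv.norm_map _ _

omit [IsManifold (𝓡 m) ∞ M] in
lemma toDual_riemGrad (h : M → ℝ) (x : M) :
    InnerProductSpace.toDual ℝ (TangentSpace (𝓡 m) x) (riemGrad h x) =
      differential (m := m) h x :=
  LinearIsometryEquiv.apply_symm_apply _ _

/-- The differentials of the pullbacks of `f` to the tangent spaces are Lipschitz at zero, uniformly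
over compact sets. -/
def PullbackLipschitz (R : TangentBundle (𝓡 m) M → M) (f : M → Ω → ℝ) : Prop :=
  ∀ K : Set M, IsCompact K → ∀ r : ℝ, 0 < r → ∃ C : ℝ, 0 < C ∧
    ∀ x ∈ K, ∀ v : TangentSpace (𝓡 m) x, ‖v‖ ≤ r → ∀ w : Ω,
      ‖fderiv ℝ (fun u : TangentSpace (𝓡 m) x => f (restrictFiber R x u) w) v
        - fderiv ℝ (fun u : TangentSpace (𝓡 m) x => f (restrictFiber R x u) w) 0‖ ≤ C * ‖v‖

omit [IsManifold (𝓡 m) ∞ M] in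
lemma HasLocallyRLipschitzGradient.pullbackLipschitz (hf : HasLocallyRLipschitzGradient R f) :
    PullbackLipschitz R f := by
  intro K hK r hr
  obtain ⟨C, hC, h⟩ := hf K hK r hr
  refine ⟨C, hC, fun x hx v hv w => ?_⟩
  rw [← norm_gradient_sub_gradient]
  exact h x hx v hv w

namespace PullbackLipschitz

omit [IsManifold (𝓡 m) ∞ M] in
lemma continuousAt_fderiv (hf : PullbackLipschitz R f) (x : M) (w : Ω) :
    ContinuousAt
      (fderiv ℝ (fun u : TangentSpace (𝓡 m) x => f (restrictFiber R x u) w)) 0 := by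
  obtain ⟨C, -, h⟩ := hf {x} isCompact_singleton 1 one_pos
  refine (tendsto_iff_norm_sub_tendsto_zero (E := NormedMap (TangentSpace (𝓡 m) x) ℝ)).2 ?_
  have h0 : Tendsto (fun v : TangentSpace (𝓡 m) x => C * ‖v‖) (𝓝 0) (𝓝 0) := by
    have : Continuous (fun v : TangentSpace (𝓡 m) x => C * ‖v‖) := by fun_prop
    simpa using this.tendsto 0
  refine squeeze_zero' (Eventually.of_forall fun _ => norm_nonneg _) ?_ h0
  filter_upwards [Metric.closedBall_mem_nhds (0 : TangentSpace (𝓡 m) x) one_pos] with v hv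
  exact h x rfl v (by simpa using hv) w

lemma continuous_riemGrad
    [IsContinuousRiemannianBundle (EuclideanSpace ℝ (Fin m)) (fun x : M => TangentSpace (𝓡 m) x)]
    (hf : PullbackLipschitz R f) (hR : IsRetraction R)
    (hd : DifferentiableInM m f) (w : Ω) :
    Continuous (fun y : M => (⟨y, riemGrad (fun z => f z w) y⟩ : TangentBundle (𝓡 m) M)) :=
  hR.continuous_riemGrad (hd w) fun x => hf.continuousAt_fderiv x w

/-- First-order Taylor expansion along the retraction, with a quadratic remainder uniform over
compact sets. -/
lemma exists_abs_sub_sub_le (hf : PullbackLipschitz R f) (hR : IsRetraction R)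
    (hd : DifferentiableInM m f) {K : Set M} (hK : IsCompact K) {r : ℝ} (hr : 0 < r) :
    ∃ C : ℝ, 0 < C ∧ ∀ x ∈ K, ∀ v : TangentSpace (𝓡 m) x, ‖v‖ ≤ r → ∀ w : Ω,
      |f (restrictFiber R x v) w - f x w - differential (m := m) (fun z => f z w) x v| ≤
        C * ‖v‖ ^ 2 := by
  obtain ⟨C, hC, h⟩ := hf K hK r hr
  refine ⟨C, hC, fun x hx v hv w => ?_⟩
  have hdiff : ∀ u : TangentSpace (𝓡 m) x,
      DifferentiableAt ℝ (fun u : TangentSpace (𝓡 m) x => f (restrictFiber R x u) w) u :=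
    fun u => (hR.hasFDerivAt_comp (h := fun z => f z w) x u (hd w _)).differentiableAt
  have h0 : fderiv ℝ (fun u : TangentSpace (𝓡 m) x => f (restrictFiber R x u) w) 0 =
      differential (m := m) (fun z => f z w) x :=
    (hR.hasFDerivAt_comp_zero (h := fun z => f z w) x (hd w x)).fderiv
  -- Mean value inequality on the ball of radius ‖v‖, where the derivative differs from its value at
  -- 0 by at most C‖v‖.
  have key := (convex_closedBall (0 : TangentSpace (𝓡 m) x) ‖v‖).norm_image_sub_le_of_norm_fderiv_le'
    (f := fun u : TangentSpace (𝓡 m) x => f (restrictFiber R x u) w)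
    (φ := differential (m := m) (fun z => f z w) x) (C := C * ‖v‖) (x := 0) (y := v)
    (fun u _ => hdiff u) (fun u hu => ?_) (by simp) (by simp)
  · simp only [hR.map_zero, sub_zero, Real.norm_eq_abs] at key
    refine key.trans (le_of_eq (by ring))
  · rw [mem_closedBall_zero_iff] at hu
    rw [← h0]
    exact (h x hx u (hu.trans hv) w).trans (by gcongr)

end PullbackLipschitz

variable [MeasurableSpace Ω]

lemma measurable_differential (hR : IsRetraction R) (hmeas : ∀ x : M, Measurable (f x))
    (hd : DifferentiableInM m f) (x : M) (v : TangentSpace (𝓡 m) x) :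
    Measurable fun w => differential (m := m) (fun z => f z w) x v := by
  -- The differential is a limit of difference quotients with step 1/n, each measurable in the
  -- sample.
  have hlim : ∀ w, Tendsto (fun n : ℕ => (n : ℝ) •
      (f (restrictFiber R x (0 + (n : ℝ)⁻¹ • v)) w - f (restrictFiber R x 0) w)) atTop
      (𝓝 (differential (m := m) (fun z => f z w) x v)) := fun w =>
    (hR.hasFDerivAt_comp_zero (h := fun z => f z w) x (hd w x)).lim v
      (by simpa using tendsto_natCast_atTop_atTop (R := ℝ))
  refine measurable_of_tendsto_metrizable (fun n => ?_) (tendsto_pi_nhds.2 hlim)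
  exact ((hmeas _).sub (hmeas _)).const_smul (n : ℝ)

/-- Expansion in an orthonormal basis reduces this to directional derivatives. Strong measurability
needs no σ-algebra on the tangent space. -/
lemma stronglyMeasurable_gradM (hR : IsRetraction R) (hmeas : ∀ x : M, Measurable (f x))
    (hd : DifferentiableInM m f) (x : M) : StronglyMeasurable (gradM (m := m) f x) := by
  let b := stdOrthonormalBasis ℝ (TangentSpace (𝓡 m) x)
  have h : gradM (m := m) f x =
      fun w => ∑ i, (differential (m := m) (fun z => f z w) x (b i)) • b i := by
    funext w
    rw [← b.sum_repr' (gradM f x w)]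
    refine Finset.sum_congr rfl fun i _ => ?_
    rw [real_inner_comm, gradM, inner_riemGrad]
  rw [h]
  exact Finset.stronglyMeasurable_fun_sum _ fun i _ =>
    (measurable_differential hR hmeas hd x (b i)).stronglyMeasurable.smul_const _

variable (μ : Measure Ω) [IsProbabilityMeasure μ]

lemma integrable_differential (hR : IsRetraction R) (hmeas : ∀ x : M, Measurable (f x))
    (hd : DifferentiableInM m f)
    (hgrad : LocallyBoundedInM (fun (x : M) (w : Ω) => ‖gradM (m := m) f x w‖)) (x : M) :
    Integrable (fun w => differential (m := m) (fun z => f z w) x) μ := by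
  obtain ⟨C, -, hC⟩ := hgrad {x} isCompact_singleton
  refine Integrable.of_bound (C := C) ?_ (ae_of_all _ fun w => ?_)
  · have h := (InnerProductSpace.toDual ℝ (TangentSpace (𝓡 m) x)).continuous.comp_stronglyMeasurable
      (stronglyMeasurable_gradM hR hmeas hd x)
    have e : (fun w => differential (m := m) (fun z => f z w) x) =
        InnerProductSpace.toDual ℝ (TangentSpace (𝓡 m) x) ∘ gradM f x :=
      funext fun w => (toDual_riemGrad _ _).symm
    rw [e]
    exact h.aestronglyMeasurable
  · have := hC x rfl w
    rwa [abs_norm, gradM, norm_riemGrad] at this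

/-- Differentiation under the integral sign on the manifold, through the retraction. -/
lemma hasFDerivAt_integral_restrictFiber (hR : IsRetraction R) (hmeas : ∀ x : M, Measurable (f x))
    (hd : DifferentiableInM m f) (hbdd : LocallyBoundedInM f)
    (hgrad : LocallyBoundedInM (fun (x : M) (w : Ω) => ‖gradM (m := m) f x w‖))
    (hlip : PullbackLipschitz R f) (x : M) :
    HasFDerivAt (fun u : TangentSpace (𝓡 m) x => ∫ w, f (restrictFiber R x u) w ∂μ)
      (∫ w, differential (m := m) (fun z => f z w) x ∂μ) 0 := by
  obtain ⟨B, -, hB⟩ := hbdd {x} isCompact_singleton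
  obtain ⟨G, -, hG⟩ := hgrad {x} isCompact_singleton
  obtain ⟨C, hC, hL⟩ := hlip {x} isCompact_singleton 1 one_pos
  have h0 : ∀ w, fderiv ℝ (fun u : TangentSpace (𝓡 m) x => f (restrictFiber R x u) w) 0 =
      differential (m := m) (fun z => f z w) x := fun w =>
    (hR.hasFDerivAt_comp_zero (h := fun z => f z w) x (hd w x)).fderiv
  -- On the unit ball the derivative is dominated by C + G: the Lipschitz bound plus the gradient
  -- bound at `x`.
  have key := hasFDerivAt_integral_of_dominated_of_fderiv_le (μ := μ) (𝕜 := ℝ)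
    (F := fun (u : TangentSpace (𝓡 m) x) w => f (restrictFiber R x u) w)
    (F' := fun u w => fderiv ℝ (fun u : TangentSpace (𝓡 m) x => f (restrictFiber R x u) w) u)
    (x₀ := 0) (s := Metric.closedBall 0 1) (bound := fun _ => C + G)
    (Metric.closedBall_mem_nhds _ one_pos)
    (Eventually.of_forall fun u => (hmeas _).aestronglyMeasurable)
    (Integrable.of_bound (C := B) (hmeas _).aestronglyMeasurable
      (ae_of_all _ fun w => by rw [hR.map_zero]; exact hB x rfl w))
    (by simp_rw [h0]; exact (integrable_differential μ hR hmeas hd hgrad x).aestronglyMeasurable)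
    (ae_of_all _ fun w u hu => ?_) (integrable_const _)
    (ae_of_all _ fun w u _ =>
      (hR.hasFDerivAt_comp (h := fun z => f z w) x u (hd w _)).differentiableAt.hasFDerivAt)
  · simp_rw [h0] at key
    exact key
  · rw [mem_closedBall_zero_iff] at hu
    have h1 := hL x rfl u hu w
    have h2 := hG x rfl w
    rw [abs_norm, gradM, norm_riemGrad, ← h0] at h2
    calc _ ≤ _ + _ := norm_le_norm_sub_add _ (fderiv ℝ
          (fun u : TangentSpace (𝓡 m) x => f (restrictFiber R x u) w) 0)
      _ ≤ C * 1 + G := by gcongr; exact h1.trans (by gcongr)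
      _ = C + G := by ring

variable {F : M → ℝ}

lemma mdifferentiable_integral (hR : IsRetraction R) (hmeas : ∀ x : M, Measurable (f x))
    (hd : DifferentiableInM m f) (hbdd : LocallyBoundedInM f)
    (hgrad : LocallyBoundedInM (fun (x : M) (w : Ω) => ‖gradM (m := m) f x w‖))
    (hlip : PullbackLipschitz R f) (hF : ∀ x : M, F x = ∫ w, f x w ∂μ) :
    MDifferentiable (𝓡 m) 𝓘(ℝ, ℝ) F := by
  intro x
  refine hR.mdifferentiableAt_of_comp x ?_
  simp_rw [hF]
  exact (hasFDerivAt_integral_restrictFiber μ hR hmeas hd hbdd hgrad hlip x).differentiableAt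

lemma differential_integral (hR : IsRetraction R) (hmeas : ∀ x : M, Measurable (f x))
    (hd : DifferentiableInM m f) (hbdd : LocallyBoundedInM f)
    (hgrad : LocallyBoundedInM (fun (x : M) (w : Ω) => ‖gradM (m := m) f x w‖))
    (hlip : PullbackLipschitz R f) (hF : ∀ x : M, F x = ∫ w, f x w ∂μ) (x : M)
    (v : TangentSpace (𝓡 m) x) :
    differential (m := m) F x v = ∫ w, differential (m := m) (fun z => f z w) x v ∂μ := by
  have h1 := hasFDerivAt_integral_restrictFiber μ hR hmeas hd hbdd hgrad hlip x
  simp_rw [← hF] at h1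
  rw [(hR.hasFDerivAt_comp_zero x
    (mdifferentiable_integral μ hR hmeas hd hbdd hgrad hlip hF x)).unique h1]
  exact ContinuousLinearMap.integral_apply (integrable_differential μ hR hmeas hd hgrad x) v

/-- The estimate for `f` is uniform in the sample, so it survives integration after evaluation at a
tangent vector. `F` is viewed as a random function over `Unit` so that the results on `f` apply to
it. -/
lemma pullbackLipschitz_integral (hR : IsRetraction R) (hmeas : ∀ x : M, Measurable (f x))
    (hd : DifferentiableInM m f) (hbdd : LocallyBoundedInM f)
    (hgrad : LocallyBoundedInM (fun (x : M) (w : Ω) => ‖gradM (m := m) f x w‖))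
    (hlip : PullbackLipschitz R f) (hF : ∀ x : M, F x = ∫ w, f x w ∂μ) :
    PullbackLipschitz R (fun x (_ : Unit) => F x) := by
  intro K hK r hr
  obtain ⟨C, hC, h⟩ := hlip K hK r hr
  refine ⟨C, hC, fun x hx v hv _ => ?_⟩
  have hFd := mdifferentiable_integral μ hR hmeas hd hbdd hgrad hlip hF
  have hder : ∀ v u : TangentSpace (𝓡 m) x,
      Integrable (fun w => fderiv ℝ
        (fun u : TangentSpace (𝓡 m) x => f (restrictFiber R x u) w) v u) μ ∧
      fderiv ℝ (fun u : TangentSpace (𝓡 m) x => F (restrictFiber R x u)) v u =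
      ∫ w, fderiv ℝ (fun u : TangentSpace (𝓡 m) x => f (restrictFiber R x u) w) v u ∂μ := by
    intro v u
    have e1 : ∀ w, fderiv ℝ (fun u : TangentSpace (𝓡 m) x => f (restrictFiber R x u) w) v u =
        differential (m := m) (fun z => f z w) (restrictFiber R x v)
          (fiberDifferential R x v u) := fun w => by
      rw [(hR.hasFDerivAt_comp (h := fun z => f z w) x v (hd w _)).fderiv]; rfl
    simp_rw [e1]
    rw [(hR.hasFDerivAt_comp x v (hFd _)).fderiv]
    exact ⟨(integrable_differential μ hR hmeas hd hgrad _).apply_continuousLinearMap _,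
      differential_integral μ hR hmeas hd hbdd hgrad hlip hF _ _⟩
  refine ContinuousLinearMap.opNorm_le_bound _ (by positivity) fun u => ?_
  rw [sub_apply, (hder v u).2, (hder 0 u).2,
    ← integral_sub (hder v u).1 (hder 0 u).1]
  have := norm_integral_le_of_norm_le_const (μ := μ) (C := C * ‖v‖ * ‖u‖)
    (f := fun w => fderiv ℝ (fun u : TangentSpace (𝓡 m) x => f (restrictFiber R x u) w) v u -
      fderiv ℝ (fun u : TangentSpace (𝓡 m) x => f (restrictFiber R x u) w) 0 u)
    (ae_of_all _ fun w => ?_)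
  · simpa using this
  · rw [← sub_apply]
    exact (ContinuousLinearMap.le_opNorm _ _).trans (by gcongr; exact h x hx v hv w)

/-- By symmetry of the inner product, dF(∇_M f) is the differential of `f` in the fixed direction
∇F. Its mean is dF(∇F). -/
lemma integral_inner_gradM (hR : IsRetraction R) (hmeas : ∀ x : M, Measurable (f x))
    (hd : DifferentiableInM m f) (hbdd : LocallyBoundedInM f)
    (hgrad : LocallyBoundedInM (fun (x : M) (w : Ω) => ‖gradM (m := m) f x w‖))
    (hlip : PullbackLipschitz R f) (hF : ∀ x : M, F x = ∫ w, f x w ∂μ) (x : M) :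
    ∫ w, differential (m := m) F x (gradM f x w) ∂μ = ‖(riemGrad F x : TangentSpace (𝓡 m) x)‖ ^ 2 := by
  have h1 : ∀ w, differential (m := m) F x (gradM f x w) =
      differential (m := m) (fun z => f z w) x (riemGrad F x) := fun w => by
    rw [← inner_riemGrad, ← inner_riemGrad, real_inner_comm]; rfl
  simp_rw [h1]
  rw [← differential_integral μ hR hmeas hd hbdd hgrad hlip hF, ← inner_riemGrad,
    real_inner_self_eq_norm_sq]

end RandomFunction

/-! ### Second-order control of the confinement function -/

section Confinement

/-- Second-order upper bound along the ray in direction `-g`. -/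
lemma apply_neg_smul_le_of_hessian_le {V : Type*} [NormedAddCommGroup V] [InnerProductSpace ℝ V]
    {H : V → ℝ} (hH : ContDiff ℝ 2 H) (g : V) {θ L : ℝ} (hθ : 0 ≤ θ)
    (hL : ∀ ζ : ℝ, |ζ| ≤ θ → hessian H (ζ • g) g g ≤ L) :
    H (-θ • g) ≤ H 0 - θ * fderiv ℝ H 0 g + L * θ ^ 2 / 2 := by
  have hline : ∀ s : ℝ, HasDerivAt (fun s : ℝ => -s • g) (-g) s := fun s => by
    simpa using ((hasDerivAt_id s).neg).smul_const g
  have hd1 : ∀ s : ℝ, HasDerivAt (fun s : ℝ => H (-s • g)) (-(fderiv ℝ H (-s • g) g)) s :=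
    fun s => by
    have h1 := ((hH.differentiable two_ne_zero _).hasFDerivAt (x := -s • g)).comp_hasDerivAt s
      (hline s)
    exact h1.congr_deriv (map_neg _ _)
  have hH1 : Differentiable ℝ (fderiv ℝ H) :=
    (hH.fderiv_right (m := 1) (by norm_num)).differentiable one_ne_zero
  have hd2 : ∀ s : ℝ, HasDerivAt (fun s : ℝ => -(fderiv ℝ H (-s • g) g))
      (hessian H (-s • g) g g) s := fun s => by
    have h1 := ((hH1 (-s • g)).hasFDerivAt).comp_hasDerivAt s (hline s)
    have h2 := (h1.clm_apply (hasDerivAt_const s g)).neg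
    exact h2.congr_deriv (by simp [hessian])
  -- The Hessian bound is integrated twice by monotonicity: first for the derivative along the ray,
  -- then for the value.
  have hp1 : ∀ s ∈ Icc 0 θ, -(fderiv ℝ H (-s • g) g) + fderiv ℝ H 0 g - L * s ≤ 0 := by
    have hanti : AntitoneOn (fun s : ℝ => -(fderiv ℝ H (-s • g) g) + fderiv ℝ H 0 g - L * s)
        (Icc 0 θ) := by
      have hder : ∀ s : ℝ, HasDerivAt
          (fun s : ℝ => -(fderiv ℝ H (-s • g) g) + fderiv ℝ H 0 g - L * s)
          (hessian H (-s • g) g g - L) s := fun s => by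
        have h1 := ((hd2 s).add_const (fderiv ℝ H 0 g)).sub ((hasDerivAt_id s).const_mul L)
        exact h1.congr_deriv (by simp)
      refine antitoneOn_of_deriv_nonpos (convex_Icc _ _)
        (fun s _ => (hder s).continuousAt.continuousWithinAt)
        (fun s _ => (hder s).differentiableAt.differentiableWithinAt) fun s hs => ?_
      rw [interior_Icc] at hs
      rw [(hder s).deriv, sub_nonpos]
      refine hL _ ?_
      rw [abs_neg, abs_of_pos hs.1]
      exact hs.2.le
    intro s hs
    have := hanti (left_mem_Icc.2 hθ) hs hs.1
    simpa using this
  have hanti : AntitoneOn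
      (fun s : ℝ => H (-s • g) + s * fderiv ℝ H 0 g - L * (s ^ 2 / 2)) (Icc 0 θ) := by
    have hder : ∀ s : ℝ, HasDerivAt
        (fun s : ℝ => H (-s • g) + s * fderiv ℝ H 0 g - L * (s ^ 2 / 2))
        (-(fderiv ℝ H (-s • g) g) + fderiv ℝ H 0 g - L * s) s := fun s => by
      have h3 := (((hasDerivAt_id s).pow 2).div_const 2).const_mul L
      have := ((hd1 s).add ((hasDerivAt_id s).mul_const (fderiv ℝ H 0 g))).sub h3
      exact this.congr_deriv (by simp)
    refine antitoneOn_of_deriv_nonpos (convex_Icc _ _)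
      (fun s _ => (hder s).continuousAt.continuousWithinAt)
      (fun s _ => (hder s).differentiableAt.differentiableWithinAt) fun s hs => ?_
    rw [interior_Icc] at hs
    rw [(hder s).deriv]
    exact hp1 s (Ioo_subset_Icc_self hs)
  have := hanti (left_mem_Icc.2 hθ) (right_mem_Icc.2 hθ) hθ
  simp only [neg_zero, zero_smul, zero_mul, add_zero] at this
  norm_num at this
  simp only [neg_smul]
  linarith

variable {m : ℕ} {M : Type*} [TopologicalSpace M]
  [ChartedSpace (EuclideanSpace ℝ (Fin m)) M] [IsManifold (𝓡 m) ∞ M]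
  [Bundle.RiemannianBundle (fun x : M => TangentSpace (𝓡 m) x)]

variable {R : TangentBundle (𝓡 m) M → M} {Ω : Type*} {f : M → Ω → ℝ} {ρ : M → ℝ}

lemma le_of_ofReal_one_div_mul_sSup_le {Z : Set ENNReal} {a φ y : ℝ} (ha : 0 < a) (hφ : 0 ≤ φ)
    (hZ : ENNReal.ofReal (1 / a) * sSup Z ≤ ENNReal.ofReal φ) (hy : ENNReal.ofReal y ∈ Z) :
    y ≤ a * φ := by
  have h1 : ENNReal.ofReal (1 / a) * ENNReal.ofReal y ≤ ENNReal.ofReal φ :=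
    (mul_le_mul_right (le_sSup hy) _).trans hZ
  rw [← ENNReal.ofReal_mul (by positivity), ENNReal.ofReal_le_ofReal_iff hφ] at h1
  rw [one_div, inv_mul_le_iff₀ ha] at h1
  exact h1

omit [IsManifold (𝓡 m) ∞ M] in
lemma neg_inner_le_of_constA_le {ρ₀ a φ : ℝ} (ha : 0 < a) (hφ : 0 ≤ φ)
    (hA : constA m f ρ ρ₀ a ≤ ENNReal.ofReal φ) {x : M} (hx : ρ x ≤ ρ₀) (w : Ω) :
    -(inner ℝ (riemGrad ρ x : TangentSpace (𝓡 m) x) (gradM f x w)) ≤ a * φ :=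
  (le_max_right 0 _).trans (le_of_ofReal_one_div_mul_sSup_le ha hφ hA ⟨x, w, hx, rfl⟩)

omit [IsManifold (𝓡 m) ∞ M] in
lemma hessian_le_of_constB_le {ρ₁ b Θ φ : ℝ} (hb : 0 < b) (hφ : 0 ≤ φ)
    (hB : constB R f ρ ρ₁ b Θ ≤ ENNReal.ofReal φ) {x : M} (hx : ρ x ≤ ρ₁) (w : Ω) {θ : ℝ}
    (hθ : |θ| ≤ Θ) :
    hessian (fun u : TangentSpace (𝓡 m) x => ρ (restrictFiber R x u))
        (θ • gradM f x w) (gradM f x w) (gradM f x w) ≤ (b * φ) ^ 2 := by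
  have h := le_of_ofReal_one_div_mul_sSup_le hb hφ hB ⟨θ, x, w, hθ, hx, rfl⟩
  exact (le_max_right 0 _).trans ((Real.sqrt_le_left (by positivity)).1 h)

/-- One step of the descent changes the confinement by at most a second-order term outside the
sublevel `ρ₀`, and keeps the bound `ρ₀ + cmax * a` plus a second-order term inside it. -/
lemma IsRetraction.confinement_step (hR : IsRetraction R)
    (hR2 : ContMDiff (𝓡 m).tangent (𝓡 m) 2 R) (hρ2 : ContMDiff (𝓡 m) 𝓘(ℝ, ℝ) 2 ρ)
    {ρ₀ ρ₁ a b Θ φ : ℝ} (hρ₀ : ConfinesAbove m f ρ ρ₀) (ha : 0 < a) (hb : 0 < b) (hφ : 0 < φ)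
    (hA : constA m f ρ ρ₀ a ≤ ENNReal.ofReal φ) (hB : constB R f ρ ρ₁ b Θ ≤ ENNReal.ofReal φ)
    {c cmax : ℝ} (hc : 0 < c) (hcc : c ≤ cmax) (hΘ : c / φ ≤ Θ) {x : M} (hx : ρ x ≤ ρ₁) (w : Ω)
    {l : ℝ} (hl : ρ₀ + cmax * a ≤ l) (hxl : ρ x ≤ l) :
    ρ (restrictFiber R x (-(c / φ) • gradM f x w)) ≤ l + b ^ 2 * c ^ 2 / 2 := by
  have hρd : MDifferentiable (𝓡 m) 𝓘(ℝ, ℝ) ρ := hρ2.mdifferentiable two_ne_zero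
  have hH : ContDiff ℝ 2 (fun u : TangentSpace (𝓡 m) x => ρ (restrictFiber R x u)) :=
    (hρ2.comp (contMDiff_restrictFiber ENat.LEInfty.out hR2 x)).contDiff
  have h := apply_neg_smul_le_of_hessian_le hH (gradM f x w) (θ := c / φ) (by positivity)
    fun ζ hζ => hessian_le_of_constB_le hb hφ.le hB hx w (hζ.trans hΘ)
  rw [(hR.hasFDerivAt_comp_zero x (hρd x)).fderiv, ← inner_riemGrad, hR.map_zero] at h
  -- The factor φ in the Hessian bound cancels the one in the step size.
  have e : (b * φ) ^ 2 * (c / φ) ^ 2 / 2 = b ^ 2 * c ^ 2 / 2 := by field_simp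
  rw [e] at h
  have hcφ : 0 < c / φ := by positivity
  refine h.trans ?_
  gcongr
  rcases le_total (ρ x) ρ₀ with h0 | h0
  · have h1 := mul_le_mul_of_nonneg_left (neg_inner_le_of_constA_le ha hφ.le hA h0 w) hcφ.le
    have h2 : c / φ * (a * φ) = c * a := by field_simp
    have h3 : c * a ≤ cmax * a := by gcongr
    nlinarith
  · have h1 := mul_nonneg hcφ.le (hρ₀ w x h0)
    linarith

end Confinement

/-! ### Cluster points of a sequence with summable weighted values -/

section DeterministicLimit

variable {m : ℕ} {M : Type*} [TopologicalSpace M] [T2Space M]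
  [ChartedSpace (EuclideanSpace ℝ (Fin m)) M] [IsManifold (𝓡 m) ∞ M]
  [Bundle.RiemannianBundle (fun x : M => TangentSpace (𝓡 m) x)]
  [IsContinuousRiemannianBundle (EuclideanSpace ℝ (Fin m)) (fun x : M => TangentSpace (𝓡 m) x)]

/-- If steps along the retraction are of size `O(c t)` with `∑ c t = ∞` and `∑ c t * N (y t) < ∞`,
then `N` vanishes at the cluster points of `y`. -/
lemma IsRetraction.eq_zero_of_mapClusterPt {R : TangentBundle (𝓡 m) M → M} (hR : IsRetraction R)
    {K : Set M} (hK : IsCompact K) {y : ℕ → M} (hy : ∀ t, y t ∈ K)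
    {v : ∀ t, TangentSpace (𝓡 m) (y t)} (hstep : ∀ t, y (t + 1) = restrictFiber R (y t) (v t))
    {c : ℕ → ℝ} (hc : ∀ t, 0 < c t) (hc0 : Tendsto c atTop (𝓝 0)) (hcs : ¬ Summable c)
    {D : ℝ} (hD : 0 < D) (hv : ∀ t, ‖v t‖ ≤ D * c t)
    {N : M → ℝ} (hN : Continuous N) (hN0 : ∀ z, 0 ≤ N z)
    (hsum : Summable fun t => c t * N (y t)) {z : M} (hz : MapClusterPt z atTop y) : N z = 0 := by
  by_contra hne
  have hpos : 0 < N z := lt_of_le_of_ne (hN0 z) (Ne.symm hne)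
  set ε := N z / 2 with hε
  have hε0 : 0 < ε := by positivity
  have hs : {u | ε < N u} ∈ 𝓝 z := (isOpen_lt continuous_const hN).mem_nhds (by
    change ε < N z; linarith)
  obtain ⟨ψ, -, hψs⟩ := (SmoothBumpFunction.nhds_basis_tsupport (I := 𝓡 m) z).mem_iff.1 hs
  have hψN : ∀ u, 0 < ψ u → ε < N u := fun u hu =>
    hψs (subset_closure (Function.mem_support.2 hu.ne'))
  obtain ⟨δ, hδ, C, hC, hL⟩ := hR.exists_abs_sub_le (ψ.contMDiff.of_le (by norm_num)) hK
  have hLt : ∀ᶠ t in atTop, |ψ (y (t + 1)) - ψ (y t)| ≤ C * D * c t := by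
    have : ∀ᶠ t in atTop, D * c t < δ := by
      have := hc0.const_mul D
      rw [mul_zero] at this
      exact this.eventually_lt_const hδ
    filter_upwards [this] with t ht
    rw [hstep t]
    refine (hL _ (hy t) _ ((hv t).trans ht.le)).trans ?_
    rw [mul_assoc]
    gcongr
    exact hv t
  -- With increments below 1/3, a step starting where `ψ` vanishes ends below the truncation level
  -- 2/3, so only steps starting where `ψ` is positive change the truncated bump.
  have hsmall : ∀ᶠ t in atTop, C * D * c t < 1 / 3 := by
    have := hc0.const_mul (C * D)
    rw [mul_zero] at this
    exact this.eventually_lt_const (by norm_num)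
  have hinc : ∀ᶠ t in atTop,
      dist (max (ψ (y t)) (2 / 3)) (max (ψ (y (t + 1))) (2 / 3)) ≤
        C * D / ε * (c t * N (y t)) := by
    filter_upwards [hLt, hsmall] with t h1 h2
    by_cases h0 : 0 < ψ (y t)
    · rw [Real.dist_eq]
      refine (abs_max_sub_max_le_abs _ _ _).trans ?_
      rw [abs_sub_comm]
      refine h1.trans ?_
      have h3 := hψN _ h0
      -- Inside the support N > ε, so the step size is controlled by a summable term.
      have h4 : c t ≤ (c t * N (y t)) / ε := by
        rw [le_div_iff₀ hε0]
        have := hc t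
        gcongr
      calc C * D * c t ≤ C * D * ((c t * N (y t)) / ε) := by gcongr
        _ = _ := by ring
    · have h3 : ψ (y t) ≤ 0 := not_lt.1 h0
      have h4 := (abs_le.1 h1).2
      rw [max_eq_right (by linarith), max_eq_right (by linarith), dist_self]
      have := hc t
      have := hN0 (y t)
      positivity
  have hcauchy : CauchySeq fun t => max (ψ (y t)) (2 / 3) := by
    refine cauchySeq_of_summable_dist ?_
    exact Summable.of_norm_bounded_eventually_nat (hsum.mul_left (C * D / ε))
      (hinc.mono fun t ht => by rwa [Real.norm_of_nonneg dist_nonneg])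
  obtain ⟨l, hl⟩ := cauchySeq_tendsto_of_complete hcauchy
  -- `ψ` is 1 near the cluster point, which is visited infinitely often; this forces the limit to be
  -- 1.
  have hfreq : ∃ᶠ t in atTop, max (ψ (y t)) (2 / 3) = 1 := by
    have h1 : ∃ᶠ t in atTop, ψ (y t) = 1 := hz.frequently ψ.eventuallyEq_one
    exact h1.mono fun t ht => by rw [ht]; norm_num
  have hl1 : l = 1 := by
    by_contra hne
    exact hfreq (hl.eventually_ne hne)
  have hev : ∀ᶠ t in atTop, 2 / 3 < max (ψ (y t)) (2 / 3) :=
    hl.eventually_const_lt (by rw [hl1]; norm_num)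
  refine hcs (Summable.of_norm_bounded_eventually_nat (hsum.mul_left ε⁻¹) ?_)
  filter_upwards [hev] with t ht
  have h1 : 2 / 3 < ψ (y t) := (lt_max_iff.1 ht).resolve_right (lt_irrefl _)
  have h2 := hψN (y t) (by linarith)
  have h3 := hc t
  rw [Real.norm_of_nonneg h3.le, inv_mul_eq_div, le_div_iff₀ hε0]
  gcongr

/-- Each subsequence has, by compactness, a further one converging to a cluster point, where `N` is
zero. -/
lemma tendsto_zero_of_mapClusterPt {X : Type*} [TopologicalSpace X] [FirstCountableTopology X]
    {K : Set X} (hK : IsCompact K) {y : ℕ → X} (hy : ∀ t, y t ∈ K) {N : X → ℝ}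
    (hN : Continuous N) (h : ∀ z, MapClusterPt z atTop y → N z = 0) :
    Tendsto (fun t => N (y t)) atTop (𝓝 0) := by
  refine tendsto_of_subseq_tendsto fun ns hns => ?_
  obtain ⟨z, -, k, hk, hkz⟩ := hK.tendsto_subseq (x := fun n => y (ns n)) fun n => hy _
  refine ⟨k, ?_⟩
  have hz : MapClusterPt z atTop y := by
    have h1 : MapClusterPt z atTop (y ∘ (ns ∘ k)) := hkz.mapClusterPt
    exact h1.of_comp (hns.comp hk.tendsto_atTop)
  rw [← h z hz]
  exact (hN.tendsto z).comp hkz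

end DeterministicLimit

/-! ### Supermartingale convergence with summable errors -/

section AlmostSupermartingale

variable {S : Type*} {mS : MeasurableSpace S} {P : Measure S} [IsProbabilityMeasure P]

/-- A bounded adapted sequence that decreases in conditional mean by at least `n t`, up to a
summable error, converges almost surely, and `n` is almost surely summable. -/
lemma ae_tendsto_and_summable_of_setIntegral_le {𝓕 : Filtration ℕ mS} {V n : ℕ → S → ℝ}
    {e : ℕ → ℝ} (hV : ∀ t, Measurable[𝓕 t] (V t)) (hn : ∀ t, Measurable[𝓕 t] (n t))
    {B : ℝ} (hVB : ∀ t s, |V t s| ≤ B) (hn0 : ∀ t s, 0 ≤ n t s) (hnB : ∀ t, ∃ C, ∀ s, n t s ≤ C)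
    (he0 : ∀ t, 0 ≤ e t) (he : Summable e)
    (hdec : ∀ t, ∀ A : Set S, MeasurableSet[𝓕 t] A →
      ∫ s in A, V (t + 1) s ∂P ≤ ∫ s in A, (V t s - n t s + e t) ∂P) :
    (∀ᵐ s ∂P, ∃ l, Tendsto (fun t => V t s) atTop (𝓝 l)) ∧
      ∀ᵐ s ∂P, Summable fun t => n t s := by
  have hVi : ∀ t, Integrable (V t) P := fun t =>
    Integrable.of_bound (((hV t).mono (𝓕.le t) le_rfl).aestronglyMeasurable) B
      (ae_of_all _ fun s => hVB t s)
  have hni : ∀ t, Integrable (n t) P := fun t => by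
    obtain ⟨C, hC⟩ := hnB t
    exact Integrable.of_bound (((hn t).mono (𝓕.le t) le_rfl).aestronglyMeasurable) C
      (ae_of_all _ fun s => by rw [Real.norm_of_nonneg (hn0 t s)]; exact hC s)
  -- Past decreases are added back and past errors removed; the sums stop before `t`, so `U t` is
  -- known at time `t`.
  set U : ℕ → S → ℝ := fun t s =>
    V t s + (∑ i ∈ Finset.range t, n i s) - ∑ i ∈ Finset.range t, e i with hU
  have hUi : ∀ t, Integrable (U t) P := fun t =>
    ((hVi t).add (integrable_finsetSum _ fun i _ => hni i)).sub (integrable_const _)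
  have hUm : ∀ t, Measurable[𝓕 t] (U t) := fun t => by
    have h1 : Measurable[𝓕 t] fun s => ∑ i ∈ Finset.range t, n i s :=
      Finset.measurable_fun_sum _ fun i hi =>
        (hn i).mono (𝓕.mono (Finset.mem_range.1 hi).le) le_rfl
    exact ((hV t).add h1).sub_const _
  have hsuper : Supermartingale U 𝓕 P := by
    refine supermartingale_of_setIntegral_succ_le (fun t => (hUm t).stronglyMeasurable) hUi
      fun t A hA => ?_
    have h1 := hdec t A hA
    have hi : Integrable (fun s => V t s - n t s + e t) P :=
      ((hVi t).sub (hni t)).add (integrable_const _)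
    have hW : Integrable (fun s => (∑ i ∈ Finset.range (t + 1), n i s) -
        ∑ i ∈ Finset.range (t + 1), e i) P :=
      (integrable_finsetSum _ fun i _ => hni i).sub (integrable_const _)
    calc ∫ s in A, U (t + 1) s ∂P = ∫ s in A, V (t + 1) s ∂P +
          ∫ s in A, ((∑ i ∈ Finset.range (t + 1), n i s) - ∑ i ∈ Finset.range (t + 1), e i) ∂P := by
          rw [← integral_add (hVi _).integrableOn hW.integrableOn]
          simp only [hU, add_sub_assoc]
      _ ≤ ∫ s in A, (V t s - n t s + e t) ∂P +
          ∫ s in A, ((∑ i ∈ Finset.range (t + 1), n i s) - ∑ i ∈ Finset.range (t + 1), e i) ∂P := by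
          gcongr
      _ = ∫ s in A, U t s ∂P := by
          rw [← integral_add hi.integrableOn hW.integrableOn]
          congr 1
          ext s
          simp only [hU, Finset.sum_range_succ]
          ring
  have hElow : ∀ t, ∑ i ∈ Finset.range t, e i ≤ ∑' i, e i := fun t =>
    he.sum_le_tsum _ fun i _ => he0 i
  -- `U` is bounded below by -(B + ∑ e), so its L¹ norm is controlled by its mean, which never
  -- exceeds the initial mean.
  have hUlow : ∀ t s, |U t s| ≤ U t s + 2 * (B + ∑' i, e i) := fun t s => by
    have h1 := (abs_le.1 (hVB t s)).1
    have h2 : 0 ≤ ∑ i ∈ Finset.range t, n i s := Finset.sum_nonneg fun i _ => hn0 i s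
    have h3 := hElow t
    have h4 : -(B + ∑' i, e i) ≤ U t s := by simp only [hU]; linarith
    have h5 : 0 ≤ B + ∑' i, e i :=
      add_nonneg ((abs_nonneg _).trans (hVB t s)) (tsum_nonneg he0)
    rw [abs_le]
    constructor <;> linarith
  have hbdd : ∀ t, eLpNorm ((-U) t) 1 P ≤ (Real.toNNReal (B + 2 * (B + ∑' i, e i)) : ENNReal) := by
    intro t
    have h0 : ∫ s, U t s ∂P ≤ B := by
      have h1 := hsuper.setIntegral_le (Nat.zero_le t) MeasurableSet.univ
      rw [setIntegral_univ, setIntegral_univ] at h1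
      refine h1.trans ?_
      calc ∫ s, U 0 s ∂P ≤ ∫ _, B ∂P := by
            refine integral_mono (hUi 0) (integrable_const _) fun s => ?_
            simp only [hU, Finset.range_zero, Finset.sum_empty, add_zero, sub_zero]
            exact (le_abs_self _).trans (hVB 0 s)
        _ = B := by simp
    rw [Pi.neg_apply, eLpNorm_neg, eLpNorm_one_eq_lintegral_enorm,
      ← ofReal_integral_norm_eq_lintegral_enorm (hUi t)]
    refine ENNReal.ofReal_le_ofReal ?_
    calc ∫ s, ‖U t s‖ ∂P ≤ ∫ s, (U t s + 2 * (B + ∑' i, e i)) ∂P :=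
          integral_mono (hUi t).norm ((hUi t).add (integrable_const _)) fun s => hUlow t s
      _ = ∫ s, U t s ∂P + 2 * (B + ∑' i, e i) := by
          rw [integral_add (hUi t) (integrable_const _)]; simp
      _ ≤ _ := by gcongr
  have hconv := hsuper.neg.ae_tendsto_limitProcess hbdd
  have hmain : ∀ᵐ s ∂P, (Summable fun t => n t s) ∧ ∃ l, Tendsto (fun t => V t s) atTop (𝓝 l) := by
    filter_upwards [hconv] with s hs
    have hUs : ∃ l, Tendsto (fun t => U t s) atTop (𝓝 l) :=
      ⟨_, by simpa using hs.neg⟩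
    obtain ⟨l, hl⟩ := hUs
    obtain ⟨C, hC⟩ := hl.bddAbove_range
    have hsum : Summable fun t => n t s := by
      refine summable_of_sum_range_le (c := C + B + ∑' i, e i) (fun t => hn0 t s) fun t => ?_
      have h1 : U t s ≤ C := hC ⟨t, rfl⟩
      have h2 := (abs_le.1 (hVB t s)).1
      have h3 := hElow t
      simp only [hU] at h1
      linarith
    refine ⟨hsum, l - (∑' i, n i s) + ∑' i, e i, ?_⟩
    have := (hl.sub hsum.hasSum.tendsto_sum_nat).add he.hasSum.tendsto_sum_nat
    refine this.congr fun t => ?_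
    simp only [hU]
    ring
  exact ⟨hmain.mono fun s h => h.2, hmain.mono fun s h => h.1⟩

end AlmostSupermartingale

/-! ### Independence of the current sample from the past -/

section FreshSample

variable {S Ω X : Type*} {𝒢 mS : MeasurableSpace S} {P : Measure S} [IsProbabilityMeasure P]
  {mΩ : MeasurableSpace Ω} {mX : MeasurableSpace X} {μ : Measure Ω} [IsProbabilityMeasure μ]

/-- A sample independent of the past can be integrated out. -/
lemma setIntegral_eq_setIntegral_integral_of_indep (h𝒢 : 𝒢 ≤ mS)
    {ξ : S → Ω} (hξ : Measurable ξ) (hlaw : P.map ξ = μ)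
    (hind : Indep 𝒢 (MeasurableSpace.comap ξ mΩ) P)
    {Y : S → X} (hY : Measurable[𝒢] Y) {h : X × Ω → ℝ} (hh : Measurable h)
    {B : ℝ} (hB : ∀ s w, |h (Y s, w)| ≤ B) {A : Set S} (hA : MeasurableSet[𝒢] A) :
    ∫ s in A, h (Y s, ξ s) ∂P = ∫ s in A, ∫ w, h (Y s, w) ∂μ ∂P := by
  -- Recording the indicator of `A` beside `Y` turns the integral over `A` into a full integral, to
  -- which the product law of `Z` and `ξ` and Fubini apply.
  let Z : S → X × ℝ := fun s => (Y s, A.indicator (fun _ => 1) s)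
  have hZ𝒢 : Measurable[𝒢] Z := hY.prodMk (measurable_const.indicator hA)
  have hZ : Measurable Z := hZ𝒢.mono h𝒢 le_rfl
  have hindep : IndepFun Z ξ P := by
    rw [IndepFun_iff_Indep]
    exact indep_of_indep_of_le_left hind hZ𝒢.comap_le
  have hmap := hindep.map_prod_eq_prod_map_map hZ.aemeasurable hξ.aemeasurable
  rw [hlaw] at hmap
  let q : (X × ℝ) × Ω → ℝ := fun p => p.1.2 * h (p.1.1, p.2)
  have hq : Measurable q := by
    have : Measurable fun p : (X × ℝ) × Ω => (p.1.1, p.2) := by fun_prop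
    exact (measurable_snd.comp measurable_fst).mul (hh.comp this)
  have hZξ : Measurable fun s => (Z s, ξ s) := hZ.prodMk hξ
  have hqi : Integrable q (P.map fun s => (Z s, ξ s)) := by
    rw [integrable_map_measure hq.aestronglyMeasurable hZξ.aemeasurable]
    refine Integrable.of_bound (hq.comp hZξ).aestronglyMeasurable B (ae_of_all _ fun s => ?_)
    have hB0 : 0 ≤ B := (abs_nonneg _).trans (hB s (ξ s))
    by_cases hs : s ∈ A
    · simpa [q, Z, hs] using hB s (ξ s)
    · simpa [q, Z, hs] using hB0
  have hA' : MeasurableSet A := h𝒢 _ hA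
  have : IsProbabilityMeasure (P.map Z) := Measure.isProbabilityMeasure_map hZ.aemeasurable
  calc ∫ s in A, h (Y s, ξ s) ∂P = ∫ s, q (Z s, ξ s) ∂P := by
        rw [← integral_indicator hA']
        refine integral_congr_ae (ae_of_all _ fun s => ?_)
        by_cases hs : s ∈ A <;> simp [q, Z, hs]
    _ = ∫ p, q p ∂(P.map fun s => (Z s, ξ s)) :=
        (integral_map hZξ.aemeasurable hq.aestronglyMeasurable).symm
    _ = ∫ z, ∫ w, q (z, w) ∂μ ∂(P.map Z) := by
        rw [hmap] at hqi ⊢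
        exact integral_prod _ hqi
    _ = ∫ s, ∫ w, q (Z s, w) ∂μ ∂P :=
        integral_map hZ.aemeasurable
          hq.stronglyMeasurable.integral_prod_right'.aestronglyMeasurable
    _ = ∫ s in A, ∫ w, h (Y s, w) ∂μ ∂P := by
        rw [← integral_indicator hA']
        refine integral_congr_ae (ae_of_all _ fun s => ?_)
        by_cases hs : s ∈ A <;> simp [q, Z, hs]

/-- The filtration generated by the samples strictly before each time. -/
def pastFiltration (ξ : ℕ → S → Ω) (hξ : ∀ t, Measurable (ξ t)) : Filtration ℕ mS where
  seq t := ⨆ i ∈ {i | i < t}, MeasurableSpace.comap (ξ i) mΩ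
  mono' _ _ h := biSup_mono fun _ hi => lt_of_lt_of_le hi h
  le' _ := iSup₂_le fun i _ => (hξ i).comap_le

lemma measurable_pastFiltration_succ {ξ : ℕ → S → Ω} (hξ : ∀ t, Measurable (ξ t)) (t : ℕ) :
    Measurable[pastFiltration ξ hξ (t + 1)] (ξ t) :=
  Measurable.of_comap_le (le_iSup₂_of_le (f := fun i (_ : i ∈ {i | i < t + 1}) =>
    MeasurableSpace.comap (ξ i) mΩ) t (Nat.lt_succ_self t) le_rfl)

omit [IsProbabilityMeasure P] in
lemma indep_pastFiltration {ξ : ℕ → S → Ω} (hξ : ∀ t, Measurable (ξ t)) (hind : iIndepFun ξ P)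
    (t : ℕ) : Indep (pastFiltration ξ hξ t) (MeasurableSpace.comap (ξ t) mΩ) P := by
  have h := indep_iSup_of_disjoint (fun i => (hξ i).comap_le) hind.iIndep
    (S := {i | i < t}) (T := {t}) (by simp)
  rw [show pastFiltration ξ hξ t = ⨆ i ∈ {i | i < t}, MeasurableSpace.comap (ξ i) mΩ from rfl]
  simpa using h

end FreshSample

/-! ### Measurability and mean decrease of one descent step -/

section DescentStep

variable {m : ℕ} {M : Type*} [TopologicalSpace M]
  [ChartedSpace (EuclideanSpace ℝ (Fin m)) M] [IsManifold (𝓡 m) ∞ M]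
  [Bundle.RiemannianBundle (fun x : M => TangentSpace (𝓡 m) x)]
  {R : TangentBundle (𝓡 m) M → M} {Ω : Type*} {f : M → Ω → ℝ}

lemma isContinuousRiemannianBundle_tangent [h : IsContMDiffRiemannianBundle (𝓡 m) ∞
    (EuclideanSpace ℝ (Fin m)) (fun x : M => TangentSpace (𝓡 m) x)] :
    IsContinuousRiemannianBundle (EuclideanSpace ℝ (Fin m))
      (fun x : M => TangentSpace (𝓡 m) x) := by
  obtain ⟨g, hg, h⟩ := h.exists_contMDiff
  exact ⟨g, hg.continuous, h⟩

variable [IsContinuousRiemannianBundle (EuclideanSpace ℝ (Fin m))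
  (fun x : M => TangentSpace (𝓡 m) x)]

lemma continuous_norm_riemGrad {h : M → ℝ}
    (hc : Continuous (fun y : M => (⟨y, riemGrad h y⟩ : TangentBundle (𝓡 m) M))) :
    Continuous fun y : M => ‖(riemGrad h y : TangentSpace (𝓡 m) y)‖ := by
  have h1 : Continuous fun y : M => inner ℝ (riemGrad h y : TangentSpace (𝓡 m) y) (riemGrad h y) :=
    Continuous.inner_bundle (F := EuclideanSpace ℝ (Fin m))
      (E := fun x : M => TangentSpace (𝓡 m) x) (b := fun y => y) hc hc
  simp_rw [real_inner_self_eq_norm_sq] at h1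
  simpa [Real.sqrt_sq] using h1.sqrt

/-- A Carathéodory map: continuous in the point because the gradient of each sample is continuous,
and measurable in the sample. -/
lemma measurable_descentStep [MeasurableSpace Ω] [MeasurableSpace M] [BorelSpace M]
    [TopologicalSpace.MetrizableSpace M] [SecondCountableTopology M]
    (hR : IsRetraction R) (hmeas : ∀ x : M, Measurable (f x))
    (hd : DifferentiableInM m f) (hlip : PullbackLipschitz R f) (κ : ℝ) :
    Measurable fun p : M × Ω => restrictFiber R p.1 (κ • gradM f p.1 p.2) := by
  refine measurable_uncurry_of_continuous_of_measurable
    (u := fun x w => restrictFiber R x (κ • gradM f x w)) (fun w => ?_) fun x => ?_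
  · refine hR.contMDiff.continuous.comp (?_ : Continuous fun y : M =>
      (⟨y, κ • riemGrad (fun z => f z w) y⟩ : TangentBundle (𝓡 m) M))
    have h0 : ContMDiff (𝓡 m) (𝓡 m).tangent 0
        (fun y : M => (⟨y, riemGrad (fun z => f z w) y⟩ : TangentBundle (𝓡 m) M)) :=
      contMDiff_zero_iff.2 (hlip.continuous_riemGrad hR hd w)
    exact (h0.const_smul_section (a := κ)).continuous
  · exact ((hR.mdifferentiable_restrictFiber x).continuous.comp_stronglyMeasurable
      ((stronglyMeasurable_gradM hR hmeas hd x).const_smul κ)).measurable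

variable [MeasurableSpace Ω] (μ : Measure Ω) [IsProbabilityMeasure μ] {F : M → ℝ}

omit [IsContinuousRiemannianBundle (EuclideanSpace ℝ (Fin m))
  (fun x : M => TangentSpace (𝓡 m) x)] in
/-- Expected decrease in one descent step, in terms of the squared norm of the gradient. -/
lemma integral_descentStep_le (hR : IsRetraction R) (hmeas : ∀ x : M, Measurable (f x))
    (hd : DifferentiableInM m f) (hbdd : LocallyBoundedInM f)
    (hgrad : LocallyBoundedInM (fun (x : M) (w : Ω) => ‖gradM (m := m) f x w‖))
    (hlip : PullbackLipschitz R f) (hF : ∀ x : M, F x = ∫ w, f x w ∂μ)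
    {K : Set M} (hK : IsCompact K) {T : ℝ} (hT : 0 < T) :
    ∃ C > 0, ∀ x ∈ K, ∀ θ : ℝ, 0 ≤ θ → θ ≤ T →
      Integrable (fun w => F (restrictFiber R x (-θ • gradM f x w))) μ →
      ∫ w, F (restrictFiber R x (-θ • gradM f x w)) ∂μ ≤
        F x - θ * ‖(riemGrad F x : TangentSpace (𝓡 m) x)‖ ^ 2 + C * θ ^ 2 := by
  obtain ⟨G, hG0, hG⟩ := hgrad K hK
  have hFd := mdifferentiable_integral μ hR hmeas hd hbdd hgrad hlip hF
  have hFl := pullbackLipschitz_integral μ hR hmeas hd hbdd hgrad hlip hF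
  -- The radius T·G covers every step with θ ≤ T on `K`.
  obtain ⟨C, hC, h⟩ := hFl.exists_abs_sub_sub_le hR (fun _ => hFd) hK (mul_pos hT hG0)
  refine ⟨C * G ^ 2, by positivity, fun x hx θ hθ hθT hint => ?_⟩
  have hGx : ∀ w, ‖gradM (m := m) f x w‖ ≤ G := fun w => by simpa using hG x hx w
  have hi : Integrable (fun w => differential (m := m) F x (gradM f x w)) μ := by
    refine Integrable.of_bound (C := ‖differential (m := m) F x‖ * G)
      ((differential (m := m) F x).continuous.comp_stronglyMeasurable
        (stronglyMeasurable_gradM hR hmeas hd x)).aestronglyMeasurable (ae_of_all _ fun w => ?_)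
    exact ((differential (m := m) F x).le_opNorm _).trans (by gcongr; exact hGx w)
  have hpt : ∀ w, F (restrictFiber R x (-θ • gradM f x w)) ≤
      F x - θ * differential (m := m) F x (gradM f x w) + C * G ^ 2 * θ ^ 2 := fun w => by
    have hn : ‖-θ • gradM (m := m) f x w‖ = θ * ‖gradM (m := m) f x w‖ := by
      rw [norm_smul, norm_neg, Real.norm_of_nonneg hθ]
    have h1 := (abs_le.1 (h x hx (-θ • gradM f x w)
      (by rw [hn]; exact mul_le_mul hθT (hGx w) (norm_nonneg _) hT.le) ())).2
    rw [hn, map_smul, smul_eq_mul] at h1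
    have h2 : C * (θ * ‖gradM (m := m) f x w‖) ^ 2 ≤ C * (θ * G) ^ 2 := by gcongr; exact hGx w
    nlinarith
  calc _ ≤ ∫ w, (F x - θ * differential (m := m) F x (gradM f x w) + C * G ^ 2 * θ ^ 2) ∂μ :=
        integral_mono hint (((integrable_const _).sub (hi.const_mul θ)).add (integrable_const _)) hpt
    _ = _ := by
        have h1 : Integrable (fun w => F x - θ * differential (m := m) F x (gradM f x w)) μ :=
          (integrable_const _).sub (hi.const_mul θ)
        rw [integral_add h1 (integrable_const _),
          integral_sub (integrable_const _) (hi.const_mul θ), integral_const_mul,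
          integral_inner_gradM μ hR hmeas hd hbdd hgrad hlip hF]
        simp

end DescentStep

/-! ### The convergence theorem -/

theorem corollary2p2
    {m : ℕ} {M : Type*} [TopologicalSpace M] [T2Space M]
    [ChartedSpace (EuclideanSpace ℝ (Fin m)) M] [IsManifold (𝓡 m) ∞ M]
    [Bundle.RiemannianBundle (fun x : M => TangentSpace (𝓡 m) x)]
    [IsContMDiffRiemannianBundle (𝓡 m) ∞ (EuclideanSpace ℝ (Fin m))
      (fun x : M => TangentSpace (𝓡 m) x)]
    (R : TangentBundle (𝓡 m) M → M) (hR : IsRetraction R)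
    (hR2 : ContMDiff (𝓡 m).tangent (𝓡 m) 2 R)
    {Ω : Type*} [MeasurableSpace Ω] (μ : MeasureTheory.Measure Ω)
    [MeasureTheory.IsProbabilityMeasure μ]
    (f : M → Ω → ℝ) (hf_meas : ∀ x : M, Measurable (f x))
    (hf_diff : DifferentiableInM m f)
    (hf_bdd : LocallyBoundedInM f)
    (hgrad_bdd : LocallyBoundedInM (fun (x : M) (w : Ω) => ‖gradM (m := m) f x w‖))
    (hf_lip : HasLocallyRLipschitzGradient R f)
    (F : M → ℝ) (hF : ∀ x : M, F x = ∫ w, f x w ∂μ)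
    (ρ : M → ℝ) (hρ : IsConfinement m f ρ) (hρ2 : ContMDiff (𝓡 m) 𝓘(ℝ, ℝ) 2 ρ)
    (ρ₀ : ℝ) (hρ₀ : ConfinesAbove m f ρ ρ₀)
    {S : Type*} [MeasurableSpace S] (P : MeasureTheory.Measure S)
    [MeasureTheory.IsProbabilityMeasure P]
    (ξ : ℕ → S → Ω) (hξ_meas : ∀ t : ℕ, Measurable (ξ t))
    (hξ_indep : ProbabilityTheory.iIndepFun ξ P)
    (hξ_law : ∀ t : ℕ, P.map (ξ t) = μ)
    (a b Θ : ℝ) (ha : 0 < a) (hb : 0 < b) (hΘ : 0 < Θ)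
    (c : ℕ → ℝ) (hc_pos : ∀ t : ℕ, 0 < c t)
    (hc_sum : Filter.Tendsto (fun n : ℕ => ∑ t ∈ Finset.range n, c t) Filter.atTop Filter.atTop)
    (hc_sq : Summable (fun t : ℕ => c t ^ 2))
    (cmax : ℝ) (hcmax : IsGreatest (Set.range c) cmax)
    (σ : ℝ) (hσ : HasSum (fun t : ℕ => c t ^ 2) σ)
    (ρ₁ : ℝ) (hρ₁ : ρ₁ = ρ₀ + cmax * a + b ^ 2 * σ / 2)
    (x₀ : M) (hx₀ : ρ x₀ ≤ ρ₀)
    (φ : ℝ) (hφ_pos : 0 < φ)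
    (hφ : max (max (constA m f ρ ρ₀ a) (constB R f ρ ρ₁ b Θ)) (ENNReal.ofReal (cmax / Θ))
      ≤ ENNReal.ofReal φ)
    (x : ℕ → S → M) (hx : x = sgdIterate R f c φ ξ x₀) :
    (IsCompact {y : M | ρ y ≤ ρ₁} ∧ (∀ (t : ℕ) (s : S), ρ (x t s) ≤ ρ₁) ∧
      ∀ s : S, ∃ (y : M) (k : ℕ → ℕ), StrictMono k ∧
        Filter.Tendsto (fun n : ℕ => x (k n) s) Filter.atTop (𝓝 y)) ∧
    MDifferentiable (𝓡 m) 𝓘(ℝ, ℝ) F ∧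
    (∀ᵐ s ∂P, ∃ l : ℝ, Filter.Tendsto (fun t : ℕ => F (x t s)) Filter.atTop (𝓝 l)) ∧
    (∀ᵐ s ∂P, Filter.Tendsto
      (fun t : ℕ => ‖(riemGrad F (x t s) : TangentSpace (𝓡 m) (x t s))‖) Filter.atTop (𝓝 0)) ∧
    (∀ᵐ s ∂P, ∀ y : M, MapClusterPt y Filter.atTop (fun t : ℕ => x t s) →
      IsStationaryPoint m F y) := by

  have := isContinuousRiemannianBundle_tangent (m := m) (M := M)
  have hlip := hf_lip.pullbackLipschitz
  have hFd := mdifferentiable_integral μ hR hf_meas hf_diff hf_bdd hgrad_bdd hlip hF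
  have hFl := pullbackLipschitz_integral μ hR hf_meas hf_diff hf_bdd hgrad_bdd hlip hF
  have hNc : Continuous fun y : M => ‖(riemGrad F y : TangentSpace (𝓡 m) y)‖ :=
    continuous_norm_riemGrad (hFl.continuous_riemGrad hR (fun _ => hFd) ())
  -- The compact sublevels of `ρ` exhaust `M`. With the Hausdorff property this gives metrizability
  -- and second countability, needed for joint measurability.
  have : SigmaCompactSpace M := by
    refine ⟨⟨fun n : ℕ => {y : M | ρ y ≤ n}, fun n => hρ.isCompact_sublevel n, ?_⟩⟩
    exact iUnion_eq_univ_iff.2 fun y => exists_nat_ge (ρ y)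
  have : TopologicalSpace.MetrizableSpace M := Manifold.metrizableSpace (𝓡 m) M
  have : SecondCountableTopology M :=
    ChartedSpace.secondCountable_of_sigmaCompact (EuclideanSpace ℝ (Fin m)) M
  borelize M
  have hA : constA m f ρ ρ₀ a ≤ ENNReal.ofReal φ :=
    (le_max_left _ _).trans ((le_max_left _ _).trans hφ)
  have hB : constB R f ρ ρ₁ b Θ ≤ ENNReal.ofReal φ :=
    (le_max_right _ _).trans ((le_max_left _ _).trans hφ)
  have hcΘ : cmax / Θ ≤ φ :=
    (ENNReal.ofReal_le_ofReal_iff hφ_pos.le).1 ((le_max_right _ _).trans hφ)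
  have hcle : ∀ t, c t ≤ cmax := fun t => hcmax.2 ⟨t, rfl⟩
  have hcmax_pos : 0 < cmax := (hc_pos 0).trans_le (hcle 0)
  have hstepΘ : ∀ t, c t / φ ≤ Θ := fun t => by
    rw [div_le_iff₀ hΘ] at hcΘ
    rw [div_le_iff₀ hφ_pos]
    linarith [hcle t]
  -- confinement
  set K : Set M := {y : M | ρ y ≤ ρ₁}
  have hK : IsCompact K := hρ.isCompact_sublevel ρ₁
  -- The bound on `ρ` at time `t`: the allowance for one exit from the sublevel `ρ₀`, plus the
  -- second-order terms accumulated so far.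
  let level : ℕ → ℝ := fun t => ρ₀ + cmax * a + b ^ 2 * (∑ i ∈ Finset.range t, c i ^ 2) / 2
  have hlevel_le : ∀ t, level t ≤ ρ₁ := fun t => by
    rw [hρ₁]
    have : ∑ i ∈ Finset.range t, c i ^ 2 ≤ σ :=
      sum_le_hasSum _ (fun i _ => sq_nonneg _) hσ
    simp only [level]
    gcongr
  have hlevel_ge : ∀ t, ρ₀ + cmax * a ≤ level t := fun t => by
    have : 0 ≤ ∑ i ∈ Finset.range t, c i ^ 2 := Finset.sum_nonneg fun i _ => sq_nonneg _
    simp only [level]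
    have : 0 ≤ b ^ 2 * (∑ i ∈ Finset.range t, c i ^ 2) / 2 := by positivity
    linarith
  have hstep_level : ∀ (t : ℕ) (y : M), ρ y ≤ level t → ∀ w,
      ρ (restrictFiber R y (-(c t / φ) • gradM f y w)) ≤ level (t + 1) := fun t y hy w => by
    have h1 := hR.confinement_step hR2 hρ2 hρ₀ ha hb hφ_pos hA hB (hc_pos t) (hcle t) (hstepΘ t)
      (hy.trans (hlevel_le t)) w (hlevel_ge t) hy
    refine h1.trans (le_of_eq ?_)
    simp only [level, Finset.sum_range_succ]
    ring
  have hxsucc : ∀ t s, x (t + 1) s =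
      restrictFiber R (x t s) (-(c t / φ) • gradM f (x t s) (ξ t s)) := fun t s => by
    rw [hx]; rfl
  have hxlevel : ∀ t s, ρ (x t s) ≤ level t := by
    intro t s
    induction t with
    | zero =>
      rw [hx]
      change ρ x₀ ≤ _
      have := hlevel_ge 0
      have : 0 ≤ cmax * a := by positivity
      linarith
    | succ t ih => rw [hxsucc]; exact hstep_level t _ ih _
  have hxK : ∀ t s, x t s ∈ K := fun t s => (hxlevel t s).trans (hlevel_le t)
  -- almost sure convergence
  have hFc : Continuous F := hFd.continuous
  obtain ⟨B, hBF⟩ := hK.exists_bound_of_continuousOn hFc.continuousOn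
  obtain ⟨C₂, hC₂⟩ := hK.exists_bound_of_continuousOn hNc.continuousOn
  obtain ⟨C, hC, hdesc⟩ := integral_descentStep_le μ hR hf_meas hf_diff hf_bdd hgrad_bdd hlip hF hK
    hΘ
  let 𝓕 := pastFiltration ξ hξ_meas
  have hΦ : ∀ t, Measurable fun p : M × Ω => restrictFiber R p.1 (-(c t / φ) • gradM f p.1 p.2) :=
    fun t => measurable_descentStep hR hf_meas hf_diff hlip _
  -- The iterate at time `t` depends only on samples strictly before `t`, hence is independent of
  -- the sample used next.
  have hx_meas : ∀ t, Measurable[𝓕 t] (x t) := by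
    intro t
    induction t with
    | zero => rw [hx]; exact measurable_const
    | succ t ih =>
      have h1 : Measurable[𝓕 (t + 1)] fun s => (x t s, ξ t s) :=
        (ih.mono (𝓕.mono t.le_succ) le_rfl).prodMk (measurable_pastFiltration_succ hξ_meas t)
      have h2 : x (t + 1) = (fun p : M × Ω =>
          restrictFiber R p.1 (-(c t / φ) • gradM f p.1 p.2)) ∘ fun s => (x t s, ξ t s) :=
        funext fun s => hxsucc t s
      rw [h2]
      exact (hΦ t).comp h1
  have hx_meas' : ∀ t, Measurable (x t) := fun t => (hx_meas t).mono (𝓕.le t) le_rfl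
  have hconv := ae_tendsto_and_summable_of_setIntegral_le (P := P) (𝓕 := 𝓕)
    (V := fun t s => F (x t s))
    (n := fun t s => c t / φ * ‖(riemGrad F (x t s) : TangentSpace (𝓡 m) (x t s))‖ ^ 2)
    (e := fun t => C * (c t / φ) ^ 2)
    (fun t => hFc.measurable.comp (hx_meas t))
    (fun t => (((hNc.pow 2).measurable.comp (hx_meas t)).const_mul _))
    (B := B) (fun t s => hBF _ (hxK t s))
    (fun t s => by have := hc_pos t; positivity)
    (fun t => ⟨c t / φ * C₂ ^ 2, fun s => by
      have := hc_pos t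
      have := hC₂ _ (hxK t s)
      rw [norm_norm] at this
      gcongr⟩)
    (fun t => by positivity)
    (by simpa only [div_pow] using (hc_sq.div_const (φ ^ 2)).mul_left C)
    (fun t A hA => by
      have hFΦ : Measurable fun p : M × Ω =>
          F (restrictFiber R p.1 (-(c t / φ) • gradM f p.1 p.2)) := hFc.measurable.comp (hΦ t)
      -- Confinement holds for every value of the sample, so the bound on `F` also holds when the
      -- sample is integrated independently.
      have hbound : ∀ s w, |F (restrictFiber R (x t s) (-(c t / φ) • gradM f (x t s) w))| ≤ B :=
        fun s w => hBF _ ((hstep_level t _ (hxlevel t s) w).trans (hlevel_le (t + 1)))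
      have h1 := setIntegral_eq_setIntegral_integral_of_indep (P := P) (𝓕.le t) (hξ_meas t)
        (hξ_law t) (indep_pastFiltration hξ_meas hξ_indep t) (hx_meas t) hFΦ hbound hA
      simp_rw [hxsucc t]
      rw [h1]
      have hbound' : ∀ s, Integrable
          (fun w => F (restrictFiber R (x t s) (-(c t / φ) • gradM f (x t s) w))) μ := fun s =>
        Integrable.of_bound (hFΦ.comp measurable_prodMk_left).aestronglyMeasurable B
          (ae_of_all _ (hbound s))
      refine integral_mono ?_ ?_ fun s => hdesc _ (hxK t s) _ (by have := hc_pos t; positivity)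
        (hstepΘ t) (hbound' s)
      · refine Integrable.of_bound (C := B) (hFΦ.stronglyMeasurable.integral_prod_right'.comp_measurable
          (hx_meas' t)).aestronglyMeasurable (ae_of_all _ fun s => ?_)
        simpa using norm_integral_le_of_norm_le_const (μ := μ)
          (f := fun w => F (restrictFiber R (x t s) (-(c t / φ) • gradM f (x t s) w)))
          (ae_of_all _ (hbound s))
      · refine Integrable.add (Integrable.sub ?_ ?_) (integrable_const _)
        · exact Integrable.of_bound (C := B) (hFc.measurable.comp (hx_meas' t)).aestronglyMeasurable
            (ae_of_all _ fun s => hBF _ (hxK t s))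
        · refine Integrable.of_bound (C := c t / φ * C₂ ^ 2)
            (((hNc.pow 2).measurable.comp (hx_meas' t)).const_mul _).aestronglyMeasurable
            (ae_of_all _ fun s => ?_)
          have h2 := hc_pos t
          have h3 := hC₂ _ (hxK t s)
          rw [norm_norm] at h3
          rw [Real.norm_of_nonneg (by positivity)]
          gcongr)
  obtain ⟨hconvF, hsumN⟩ := hconv
  -- vanishing of the gradient
  obtain ⟨G, hG0, hG⟩ := hgrad_bdd K hK
  have hcs : ¬ Summable c := fun h =>
    not_tendsto_nhds_of_tendsto_atTop hc_sum _ h.hasSum.tendsto_sum_nat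
  have hc0 : Tendsto c atTop (𝓝 0) := by
    have h1 := hc_sq.tendsto_atTop_zero.sqrt
    rw [Real.sqrt_zero] at h1
    exact h1.congr fun t => Real.sqrt_sq (hc_pos t).le
  have hcluster : ∀ᵐ s ∂P, ∀ y : M, MapClusterPt y atTop (fun t => x t s) →
      ‖(riemGrad F y : TangentSpace (𝓡 m) y)‖ = 0 := by
    filter_upwards [hsumN] with s hs y hy
    -- The summable quantity involves the squared norm, so the cluster point argument is run with
    -- `N` equal to ‖∇F‖².
    refine pow_eq_zero_iff two_ne_zero |>.1 ?_
    refine hR.eq_zero_of_mapClusterPt hK (fun t => hxK t s) (fun t => hxsucc t s) hc_pos hc0 hcs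
      (D := G / φ) (by positivity) (fun t => ?_) (hNc.pow 2) (fun _ => sq_nonneg _) ?_ hy
    · have h1 : ‖gradM (m := m) f (x t s) (ξ t s)‖ ≤ G := by simpa using hG _ (hxK t s) (ξ t s)
      have h2 : 0 ≤ c t / φ := by have := hc_pos t; positivity
      rw [norm_smul, norm_neg, Real.norm_of_nonneg h2]
      calc c t / φ * _ ≤ c t / φ * G := by gcongr
        _ = _ := by ring
    · refine (hs.mul_left φ).congr fun t => ?_
      simp only [Pi.pow_apply]
      field_simp
  refine ⟨⟨hK, hxK, fun s => ?_⟩, hFd, hconvF, ?_, ?_⟩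
  · obtain ⟨y, -, k, hk, hky⟩ := hK.tendsto_subseq (x := fun t => x t s) fun t => hxK t s
    exact ⟨y, k, hk, hky⟩
  · filter_upwards [hcluster] with s hs
    exact tendsto_zero_of_mapClusterPt hK (fun t => hxK t s) hNc hs
  · filter_upwards [hcluster] with s hs y hy
    exact ⟨hFd y, norm_eq_zero.1 (hs y hy)⟩
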